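/- Throughout, $d\ge 0$ is an integer. A labelled Delone set is (the graph of) a map from a uniformly discrete, relatively dense subset of $\mathbb R^d$ to a compact metric space of labels. Two labelled Delone sets with labels in the same space are $\varepsilon$-close if there is a one-to-one correspondence between some of their points, involving at least all points of norm $<1/\varepsilon$ of both, such that corresponding points have $\varepsilon$-close positions and $\varepsilon$-close labels; this defines the topology. A *tiling space* $\Omega$ is a space of labelled Delone sets $T$ in $\mathbb R^d$ that is the closure of a translation orbit $\{T-x : x\in\mathbb R^d\}$, that is minimal (every orbit is dense) and aperiodic ($T-x=T$ only for $x=0$). (A labelled tiling is regarded as the labelled Delone set of the punctures of its tiles, each labelled by its prototile and label.) $\Omega$ has FLC if for each $R$ there are, up to translation, only finitely many patches $T\cap B(x,R)$, $T\in\Omega$, $x\in\mathbb R^d$. A map between tiling spaces is *orbit-preserving* if it maps each orbit into an orbit; an *orbit equivalence* is a homeomorphism that maps each orbit onto an orbit. A *factor map* is a continuous map $\varphi$ with $\varphi(T-x)=\varphi(T)-x$; it is a *local derivation* if moreover for each $r>0$ there is $R>0$ such that $T\cap B(0,R)=T'\cap B(0,R)$ implies $\varphi(T)\cap B(0,r)=\varphi(T')\cap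 B(0,r)$. *Weak class.* $H^1_w(\Omega;\mathbb R^d)$ is the group of continuous $\alpha:\Omega\times\mathbb R^d\to\mathbb R^d$ with $\alpha(T,x)+\alpha(T-x,y)=\alpha(T,x+y)$, modulo those of the form $(T,v)\mapsto s(T-v)-s(T)$ with $s:\Omega\to\mathbb R^d$ continuous. For a continuous orbit-preserving $h:\Omega\to\Omega'$, the equation $h(T-v)=h(T)-h_T(v)$ defines such a cocycle $(T,v)\mapsto h_T(v)$, and $[h]_w$ is its class. *Strong class.* Let $\Omega'$ have FLC, and let $\rho>0$ be such that distinct points of any $T\in\Omega'$ are at distance at least $2\rho$. The open sets $U_x=\{T : T \text{ has a point in } B(x,\rho)\}$, $x\in\mathbb R^d$, cover $\Omega'$; let $\lambda_x(T)$ be the position of the unique point of $T\in U_x$ in $B(x,\rho)$. The functions $\lambda_x-\lambda_y$ on $U_x\cap U_y$ are locally constant and form a Čech $1$-cocycle; its class $[\mathcal F(\Omega')]\in\check H^1(\Omega';\mathbb R^d)$ is the fundamental shape class (the Čech class of the cocycle $(T,v)\mapsto v$). For a continuous map $h:\Omega\to\Omega'$ of FLC tiling spaces, $[h]_s:=h^*[\mathcal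 F(\Omega')]\in\check H^1(\Omega;\mathbb R^d)\cong H^1_s(\Omega;\mathbb R^d)$. **Theorem.** Let $\Omega,\Omega_1,\Omega_2$ be tiling spaces in $\mathbb R^d$, let $h_1:\Omega\to\Omega_1$ be an orbit equivalence and let $h_2:\Omega\to\Omega_2$ be a continuous orbit-preserving map (for instance a surjective one). 1. If $[h_1]_w=[h_2]_w$ in $H^1_w(\Omega;\mathbb R^d)$, then there is a factor map $\varphi:\Omega_1\to\Omega_2$ such that $h_2$ is homotopic to $\varphi\circ h_1$. 2. If $\Omega,\Omega_1,\Omega_2$ have FLC and $[h_1]_s=[h_2]_s$, then there is a local derivation $\varphi:\Omega_1\to\Omega_2$ such that $h_2$ is homotopic to $\varphi\circ h_1$. -/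

import Mathlib

open Topology

/-- The translation group `ℝ^d` with its Euclidean norm. -/
abbrev Euc (d : ℕ) : Type := EuclideanSpace ℝ (Fin d)

/-- A labelled Delone set in `ℝ^d` with labels in `X`, given by its graph: a set of pairs
`(position, label)`. The field `separated` says at the same time that the set of positions is
uniformly discrete and that each position carries only one label. (`Delone.DeloneSet` is not used
because it carries the two radii as data, so that equal point sets may be different terms.) -/
@[ext]
structure LabeledDelone (d : ℕ) (X : Type*) where
  carrier : Set (Euc d × X)
  separated : ∃ r : ℝ, 0 < r ∧ ∀ p ∈ carrier, ∀ q ∈ carrier, p ≠ q → r ≤ dist p.1 q.1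
  relDense : ∃ R : ℝ, 0 < R ∧ ∀ x : Euc d, ∃ p ∈ carrier, dist p.1 x < R

namespace LabeledDelone

variable {d : ℕ} {X : Type*}

/-- The translate `Λ - x = {(y - x, l) ; (y, l) ∈ Λ}`. -/
def sub (Λ : LabeledDelone d X) (x : Euc d) : LabeledDelone d X where
  carrier := {p | (p.1 + x, p.2) ∈ Λ.carrier}
  separated := by
    obtain ⟨r, hr, h⟩ := Λ.separated
    refine ⟨r, hr, fun p hp q hq hpq => ?_⟩
    have := h _ hp _ hq (fun e => hpq ?_)
    · simpa using this
    · simp only [Prod.mk.injEq, add_left_inj] at e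
      exact Prod.ext e.1 e.2
  relDense := by
    obtain ⟨R, hR, h⟩ := Λ.relDense
    refine ⟨R, hR, fun y => ?_⟩
    obtain ⟨p, hp, hpy⟩ := h (y + x)
    refine ⟨(p.1 - x, p.2), by simpa using hp, ?_⟩
    rw [← dist_add_right _ _ x]
    simpa using hpy

theorem mem_sub {Λ : LabeledDelone d X} {x : Euc d} {p : Euc d × X} :
    p ∈ (Λ.sub x).carrier ↔ (p.1 + x, p.2) ∈ Λ.carrier := Iff.rfl

theorem sub_zero (Λ : LabeledDelone d X) : Λ.sub 0 = Λ := by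
  ext p; simp [mem_sub]

theorem sub_sub (Λ : LabeledDelone d X) (x y : Euc d) : (Λ.sub x).sub y = Λ.sub (x + y) := by
  ext p; simp [mem_sub, add_assoc, add_comm x y]

/-- The orbit of `Λ` under translations. -/
def orbit (Λ : LabeledDelone d X) : Set (LabeledDelone d X) := Set.range Λ.sub

/-- The patch `Λ ∩ B(x, R)`: all labelled points whose position is at distance `< R` of `x`. -/
def patch (Λ : LabeledDelone d X) (x : Euc d) (R : ℝ) : Set (Euc d × X) :=
  {p | p ∈ Λ.carrier ∧ dist p.1 x < R}

theorem patch_finite (Λ : LabeledDelone d X) (x : Euc d) (R : ℝ) : (Λ.patch x R).Finite := by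
  obtain ⟨r, hr, h⟩ := Λ.separated
  have hinj : Set.InjOn Prod.fst Λ.carrier := by
    intro p hp q hq e
    by_contra hne
    have := h p hp q hq hne
    rw [e, dist_self] at this
    linarith
  have hpw : (Prod.fst '' Λ.carrier).Pairwise fun a b => r ≤ dist a b := by
    rintro _ ⟨p, hp, rfl⟩ _ ⟨q, hq, rfl⟩ hne
    exact h p hp q hq (fun e => hne (by rw [e]))
  have hcl : IsClosed (Prod.fst '' Λ.carrier) := Metric.isClosed_of_pairwise_le_dist hr hpw
  have hdisc : IsDiscrete (Prod.fst '' Λ.carrier) := by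
    refine ⟨DiscreteTopology.of_forall_le_dist hr ?_⟩
    intro a b hab
    exact hpw a.2 b.2 (fun e => hab (Subtype.ext e))
  have hfin := Metric.finite_isBounded_inter_isClosed hdisc (Metric.isBounded_ball (x := x) (r := R))
    hcl
  refine Set.Finite.of_finite_image (f := Prod.fst) (hfin.subset ?_)
    (hinj.mono fun p hp => hp.1)
  rintro _ ⟨p, hp, rfl⟩
  exact ⟨hp.2, p, hp.1, rfl⟩

theorem countable_carrier (T : LabeledDelone d X) : T.carrier.Countable := by
  refine (Set.countable_iUnion fun n : ℕ => (T.patch_finite 0 n).countable).mono ?_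
  intro p hp
  obtain ⟨n, hn⟩ := exists_nat_gt (dist p.1 0)
  exact Set.mem_iUnion.2 ⟨n, hp, hn⟩

variable [MetricSpace X]

/-- `Λ` and `Λ'` are `ε`-close: there is a one-to-one correspondence `M` between some points of `Λ`
and some points of `Λ'`, which involves at least all points of both sets of norm `< 1/ε`, such that
corresponding points have `ε`-close positions and `ε`-close labels. (The distance on
`Euc d × X` is the maximum of the two distances.) -/
def Near (ε : ℝ) (Λ Λ' : LabeledDelone d X) : Prop :=
  ∃ M : Euc d × X → Euc d × X → Prop,
    (∀ p q, M p q → p ∈ Λ.carrier ∧ q ∈ Λ'.carrier ∧ dist p q < ε) ∧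
    Relator.BiUnique M ∧
    (∀ p ∈ Λ.carrier, ‖p.1‖ < ε⁻¹ → ∃ q, M p q) ∧
    (∀ q ∈ Λ'.carrier, ‖q.1‖ < ε⁻¹ → ∃ p, M p q)

theorem Near.mono {δ ε : ℝ} (hδ : 0 < δ) (h : δ ≤ ε) {Λ Λ' : LabeledDelone d X}
    (H : Near δ Λ Λ') : Near ε Λ Λ' := by
  obtain ⟨M, h1, h2, h3, h4⟩ := H
  have hi : ε⁻¹ ≤ δ⁻¹ := inv_anti₀ hδ h
  exact ⟨M, fun p q hM => ⟨(h1 p q hM).1, (h1 p q hM).2.1, (h1 p q hM).2.2.trans_le h⟩, h2,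
    fun p hp hn => h3 p hp (hn.trans_le hi), fun q hq hn => h4 q hq (hn.trans_le hi)⟩

theorem Near.refl {ε : ℝ} (hε : 0 < ε) (Λ : LabeledDelone d X) : Near ε Λ Λ := by
  refine ⟨fun p q => p = q ∧ p ∈ Λ.carrier, ?_, ⟨?_, ?_⟩, ?_, ?_⟩
  · rintro p q ⟨rfl, hp⟩
    exact ⟨hp, hp, by simpa using hε⟩
  · rintro p q s ⟨rfl, -⟩ ⟨rfl, -⟩; rfl
  · rintro p q s ⟨rfl, -⟩ ⟨rfl, -⟩; rfl
  · exact fun p hp _ => ⟨p, rfl, hp⟩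
  · exact fun p hp _ => ⟨p, rfl, hp⟩

theorem Near.symm {ε : ℝ} {Λ Λ' : LabeledDelone d X} (H : Near ε Λ Λ') : Near ε Λ' Λ := by
  obtain ⟨M, h1, h2, h3, h4⟩ := H
  refine ⟨fun p q => M q p, fun p q hM => ?_, ⟨?_, ?_⟩, h4, h3⟩
  · obtain ⟨a, b, c⟩ := h1 q p hM
    exact ⟨b, a, by rwa [dist_comm]⟩
  · intro p q s hp hq; exact h2.2 hp hq
  · intro p q s hp hq; exact h2.1 hp hq

theorem Near.comp {ε δ : ℝ} (h2 : δ + δ ≤ ε) (hi : ε⁻¹ + δ ≤ δ⁻¹) (hδ : 0 < δ)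
    {Λ Λ' Λ'' : LabeledDelone d X} (H : Near δ Λ Λ') (H' : Near δ Λ' Λ'') : Near ε Λ Λ'' := by
  obtain ⟨M, a1, a2, a3, a4⟩ := H
  obtain ⟨N, b1, b2, b3, b4⟩ := H'
  refine ⟨fun p s => ∃ q, M p q ∧ N q s, ?_, ⟨?_, ?_⟩, ?_, ?_⟩
  · rintro p s ⟨q, hM, hN⟩
    refine ⟨(a1 _ _ hM).1, (b1 _ _ hN).2.1, ?_⟩
    linarith [dist_triangle p q s, (a1 _ _ hM).2.2, (b1 _ _ hN).2.2]
  · rintro p q s ⟨t, hM, hN⟩ ⟨t', hM', hN'⟩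
    have := b2.1 hN hN'
    subst this
    exact a2.1 hM hM'
  · rintro p q s ⟨t, hM, hN⟩ ⟨t', hM', hN'⟩
    have := a2.2 hM hM'
    subst this
    exact b2.2 hN hN'
  · intro p hp hn
    obtain ⟨q, hM⟩ := a3 p hp (by linarith)
    obtain ⟨-, hq, hd⟩ := a1 _ _ hM
    have hd' : dist p.1 q.1 < δ := (le_max_left _ _).trans_lt hd
    have : ‖q.1‖ ≤ ‖p.1‖ + dist p.1 q.1 := by
      rw [dist_comm, dist_eq_norm]
      linarith [norm_sub_norm_le q.1 p.1]
    obtain ⟨s, hN⟩ := b3 q hq (by linarith)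
    exact ⟨s, q, hM, hN⟩
  · intro s hs hn
    obtain ⟨q, hN⟩ := b4 s hs (by linarith)
    obtain ⟨hq, -, hd⟩ := b1 _ _ hN
    have hd' : dist q.1 s.1 < δ := (le_max_left _ _).trans_lt hd
    have : ‖q.1‖ ≤ ‖s.1‖ + dist q.1 s.1 := by
      rw [dist_eq_norm]
      linarith [norm_sub_norm_le q.1 s.1]
    obtain ⟨p, hM⟩ := a4 q hq (by linarith)
    exact ⟨p, q, hM, hN⟩

theorem exists_comp_radius {ε : ℝ} (hε : 0 < ε) :
    ∃ δ : ℝ, 0 < δ ∧ δ + δ ≤ ε ∧ ε⁻¹ + δ ≤ δ⁻¹ := by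
  have h0 : 0 < ε⁻¹ := inv_pos.2 hε
  refine ⟨min (ε / 2) (ε⁻¹ + 1)⁻¹, by positivity, ?_, ?_⟩
  · linarith [min_le_left (ε / 2) (ε⁻¹ + 1)⁻¹]
  · have h1 : min (ε / 2) (ε⁻¹ + 1)⁻¹ ≤ (ε⁻¹ + 1)⁻¹ := min_le_right _ _
    have h2 : (ε⁻¹ + 1)⁻¹ ≤ 1 := inv_le_one_of_one_le₀ (by linarith)
    have h3 : ε⁻¹ + 1 ≤ (min (ε / 2) (ε⁻¹ + 1)⁻¹)⁻¹ := by
      rw [le_inv_comm₀ (by positivity) (by positivity)]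
      exact h1
    linarith

/-- The sets of `ε`-close pairs form a basis of the uniform structure. -/
def nearBasis (d : ℕ) (X : Type*) [MetricSpace X] :
    FilterBasis (LabeledDelone d X × LabeledDelone d X) where
  sets := {S | ∃ ε : ℝ, 0 < ε ∧ S = {P | Near ε P.1 P.2}}
  nonempty := ⟨_, 1, one_pos, rfl⟩
  inter_sets := by
    rintro _ _ ⟨ε, hε, rfl⟩ ⟨δ, hδ, rfl⟩
    refine ⟨_, ⟨min ε δ, lt_min hε hδ, rfl⟩, fun P hP => ⟨?_, ?_⟩⟩
    · exact Near.mono (lt_min hε hδ) (min_le_left _ _) hP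
    · exact Near.mono (lt_min hε hδ) (min_le_right _ _) hP

/-- The topology (and uniform structure) on labelled Delone sets for which the sets `ε`-close to
`Λ`, `ε > 0`, are a basis of neighbourhoods of `Λ`. -/
instance instUniformSpace : UniformSpace (LabeledDelone d X) :=
  UniformSpace.ofCore <| UniformSpace.Core.mkOfBasis (nearBasis d X)
    (by rintro _ ⟨ε, hε, rfl⟩ Λ; exact Near.refl hε Λ)
    (by rintro _ ⟨ε, hε, rfl⟩; exact ⟨_, ⟨ε, hε, rfl⟩, fun P hP => Near.symm hP⟩)
    (by
      rintro _ ⟨ε, hε, rfl⟩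
      obtain ⟨δ, h0, h1, h2⟩ := exists_comp_radius hε
      refine ⟨_, ⟨δ, h0, rfl⟩, ?_⟩
      rintro ⟨Λ, Λ''⟩ ⟨Λ', hP, hQ⟩
      exact Near.comp h1 h2 h0 hP hQ)

theorem hasBasis_nhds (Λ : LabeledDelone d X) :
    (𝓝 Λ).HasBasis (fun ε : ℝ => 0 < ε) (fun ε => {Λ' | Near ε Λ Λ'}) := by
  have hu : (uniformity (LabeledDelone d X)).HasBasis (fun ε : ℝ => 0 < ε)
      (fun ε => {P | Near ε P.1 P.2}) := by
    refine ⟨fun t => ?_⟩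
    change t ∈ (nearBasis d X).filter ↔ _
    rw [FilterBasis.mem_filter_iff]
    constructor
    · rintro ⟨_, ⟨ε, hε, rfl⟩, h⟩; exact ⟨ε, hε, h⟩
    · rintro ⟨ε, hε, h⟩; exact ⟨_, ⟨ε, hε, rfl⟩, h⟩
  exact nhds_basis_uniformity' hu

instance : T0Space (LabeledDelone d X) := by
  have key : ∀ Λ Λ' : LabeledDelone d X, (∀ ε : ℝ, 0 < ε → Near ε Λ Λ') →
      Λ.carrier ⊆ Λ'.carrier := by
    intro Λ Λ' H p hp
    obtain ⟨r, hr, hsep⟩ := Λ'.separated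
    have h1 : ∀ ε : ℝ, 0 < ε → ∃ q ∈ Λ'.carrier, dist p q < ε := by
      intro ε hε
      have h0 : 0 < (‖p.1‖ + 1)⁻¹ := by positivity
      obtain ⟨M, a1, -, a3, -⟩ := H (min ε (‖p.1‖ + 1)⁻¹) (lt_min hε h0)
      obtain ⟨q, hq⟩ := a3 p hp (by
        have : ‖p.1‖ + 1 ≤ (min ε (‖p.1‖ + 1)⁻¹)⁻¹ := by
          rw [le_inv_comm₀ (by positivity) (lt_min hε h0)]
          exact min_le_right _ _
        linarith)
      exact ⟨q, (a1 _ _ hq).2.1, (a1 _ _ hq).2.2.trans_le (min_le_left _ _)⟩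
    obtain ⟨q, hq, hpq⟩ := h1 (r / 2) (by positivity)
    have h2 : ∀ ε : ℝ, 0 < ε → dist p q < ε := by
      intro ε hε
      obtain ⟨s, hs, hps⟩ := h1 (min ε (r / 2)) (lt_min hε (by positivity))
      have : s = q := by
        by_contra hne
        have h3 := hsep s hs q hq hne
        have h4 : dist s.1 q.1 ≤ dist s q := le_max_left _ _
        have h5 := dist_triangle_left s q p
        linarith [hps.trans_le (min_le_right _ _)]
      rw [this] at hps
      exact hps.trans_le (min_le_left _ _)
    have : dist p q = 0 := le_antisymm
      (le_of_forall_pos_le_add fun ε hε => by linarith [h2 ε hε]) dist_nonneg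
    rwa [dist_eq_zero.1 this]
  refine ⟨fun Λ Λ' h => ?_⟩
  have hn : ∀ ε : ℝ, 0 < ε → Near ε Λ Λ' := by
    intro ε hε
    have h1 : {Λ'' | Near ε Λ Λ''} ∈ 𝓝 Λ' := by
      rw [← h.nhds_eq]
      exact (hasBasis_nhds Λ).mem_of_mem hε
    exact (mem_of_mem_nhds h1 : Λ' ∈ {Λ'' | Near ε Λ Λ''})
  exact LabeledDelone.ext (Set.Subset.antisymm (key _ _ hn)
    (key _ _ fun ε hε => (hn ε hε).symm))

theorem continuous_sub : Continuous fun P : LabeledDelone d X × Euc d => P.1.sub P.2 := by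
  rw [continuous_iff_continuousAt]
  rintro ⟨Λ, x⟩
  rw [ContinuousAt, (hasBasis_nhds _).tendsto_right_iff]
  intro ε hε
  have h0 : 0 < (ε⁻¹ + ‖x‖ + 1)⁻¹ := by positivity
  obtain ⟨δ, hδ0, hδ1, hδ2, hδ3⟩ : ∃ δ : ℝ, 0 < δ ∧ δ + δ ≤ ε ∧ δ ≤ 1 ∧
      ε⁻¹ + ‖x‖ + 1 ≤ δ⁻¹ := by
    refine ⟨min (min (ε / 2) 1) (ε⁻¹ + ‖x‖ + 1)⁻¹, by positivity, ?_, ?_, ?_⟩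
    · linarith [min_le_left (min (ε / 2) 1) (ε⁻¹ + ‖x‖ + 1)⁻¹, min_le_left (ε / 2) 1]
    · exact (min_le_left _ _).trans (min_le_right _ _)
    · rw [le_inv_comm₀ (by positivity) (by positivity)]
      exact min_le_right _ _
  have hN : ∀ᶠ P : LabeledDelone d X × Euc d in 𝓝 (Λ, x), Near δ Λ P.1 ∧ dist P.2 x < δ := by
    rw [nhds_prod_eq]
    exact Filter.prod_mem_prod ((hasBasis_nhds Λ).mem_of_mem hδ0) (Metric.ball_mem_nhds x hδ0)
  filter_upwards [hN]
  rintro ⟨Λ', x'⟩ ⟨⟨M, a1, a2, a3, a4⟩, hx⟩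
  simp only at a1 a4 hx ⊢
  have hx' : ‖x'‖ ≤ ‖x‖ + δ := by
    rw [dist_eq_norm] at hx
    linarith [norm_sub_norm_le x' x]
  refine ⟨fun p q => M (p.1 + x, p.2) (q.1 + x', q.2), ?_, ⟨?_, ?_⟩, ?_, ?_⟩
  · intro p q hM
    obtain ⟨h1, h2, h3⟩ := a1 _ _ hM
    refine ⟨h1, h2, max_lt ?_ ?_⟩
    · have h4 : dist (p.1 + x) (q.1 + x') < δ := (le_max_left _ _).trans_lt h3
      have h5 : dist p.1 q.1 ≤ dist (p.1 + x) (q.1 + x') + dist x' x := by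
        rw [← dist_add_right p.1 q.1 x]
        refine (dist_triangle _ (q.1 + x') _).trans ?_
        simp
      linarith
    · have h4 : dist p.2 q.2 < δ := (le_max_right _ _).trans_lt h3
      linarith
  · intro p q s hp hq
    have := a2.1 hp hq
    simp only [Prod.mk.injEq, add_left_inj] at this
    exact Prod.ext this.1 this.2
  · intro p q s hp hq
    have := a2.2 hp hq
    simp only [Prod.mk.injEq, add_left_inj] at this
    exact Prod.ext this.1 this.2
  · intro p hp hn
    obtain ⟨q, hq⟩ := a3 _ hp (by
      change ‖p.1 + x‖ < _
      linarith [norm_add_le p.1 x])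
    exact ⟨(q.1 - x', q.2), by simpa using hq⟩
  · intro q hq hn
    obtain ⟨p, hp⟩ := a4 _ hq (by
      change ‖q.1 + x'‖ < _
      linarith [norm_add_le q.1 x'])
    exact ⟨(p.1 - x, p.2), by simpa using hp⟩

/-- The hull of `Λ`: the closure of its orbit. -/
def hull (Λ : LabeledDelone d X) : Set (LabeledDelone d X) := closure Λ.orbit

end LabeledDelone

/-- A minimal aperiodic tiling space: a nonempty set of labelled Delone sets which is the hull of
each of its elements (so it is the hull of a labelled Delone set, and every orbit in it is dense)
and none of whose elements has a nonzero period. -/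
structure TilingSpace (d : ℕ) (X : Type*) [MetricSpace X] where
  carrier : Set (LabeledDelone d X)
  nonempty : carrier.Nonempty
  hull_eq : ∀ Λ ∈ carrier, Λ.hull = carrier
  aperiodic : ∀ Λ ∈ carrier, ∀ x : Euc d, Λ.sub x = Λ → x = 0

namespace TilingSpace

variable {d : ℕ} {X : Type*} [MetricSpace X] {X' : Type*} [MetricSpace X']

instance : CoeSort (TilingSpace d X) (Type _) := ⟨fun Ω => Ω.carrier⟩

/-- The translation action `(T, x) ↦ T - x` on a tiling space. -/
def sub {Ω : TilingSpace d X} (T : Ω) (x : Euc d) : Ω :=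
  ⟨T.1.sub x, (Ω.hull_eq T.1 T.2).subset (subset_closure ⟨x, rfl⟩)⟩

theorem sub_zero {Ω : TilingSpace d X} (T : Ω) : sub T 0 = T :=
  Subtype.ext (LabeledDelone.sub_zero _)

theorem sub_sub {Ω : TilingSpace d X} (T : Ω) (x y : Euc d) : sub (sub T x) y = sub T (x + y) :=
  Subtype.ext (LabeledDelone.sub_sub _ _ _)

theorem sub_injective {Ω : TilingSpace d X} (T : Ω) {x y : Euc d} (h : sub T x = sub T y) :
    x = y := by
  have h1 : sub (sub T y) (x - y) = sub T y := by
    rw [sub_sub, add_sub_cancel, h]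
  exact sub_eq_zero.1 (Ω.aperiodic _ (sub T y).2 _ (congrArg Subtype.val h1))

theorem continuous_sub {Ω : TilingSpace d X} : Continuous fun P : Ω × Euc d => sub P.1 P.2 :=
  (LabeledDelone.continuous_sub.comp
    ((continuous_subtype_val.comp continuous_fst).prodMk continuous_snd)).subtype_mk _

/-- Finite local complexity: for each `R`, the patches of radius `R` occurring in the space
are, up to translation, finitely many. -/
def FLC (Ω : TilingSpace d X) : Prop :=
  ∀ R : ℝ, ∃ F : Set (Set (Euc d × X)), F.Finite ∧
    ∀ (T : Ω) (x : Euc d), ∃ y : Euc d,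
      (fun p : Euc d × X => (p.1 - y, p.2)) '' T.1.patch x R ∈ F

/-- `h` maps every orbit into an orbit. -/
def OrbitPreserving {Ω : TilingSpace d X} {Ω' : TilingSpace d X'} (h : Ω → Ω') : Prop :=
  ∀ (T : Ω) (v : Euc d), ∃ w : Euc d, h (sub T v) = sub (h T) w

/-- A homeomorphism `h` is an orbit equivalence if the image of every orbit is an orbit:
two elements lie in the same orbit if and only if their images do. -/
def IsOrbitEquivalence {Ω : TilingSpace d X} {Ω' : TilingSpace d X'} (h : Ω ≃ₜ Ω') : Prop :=
  ∀ T T' : Ω, (∃ v : Euc d, T' = sub T v) ↔ ∃ w : Euc d, h T' = sub (h T) w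

theorem IsOrbitEquivalence.orbitPreserving {Ω : TilingSpace d X} {Ω' : TilingSpace d X'}
    {h : Ω ≃ₜ Ω'} (hh : IsOrbitEquivalence h) : OrbitPreserving (h : C(Ω, Ω')) :=
  fun T v => (hh T (sub T v)).1 ⟨v, rfl⟩

/-- A factor map: a continuous map with `φ (T - x) = φ T - x`. -/
def IsFactorMap {Ω : TilingSpace d X} {Ω' : TilingSpace d X'} (φ : C(Ω, Ω')) : Prop :=
  ∀ (T : Ω) (x : Euc d), φ (sub T x) = sub (φ T) x

/-- A local map: `φ T ∩ B(0, r)` is determined by `T ∩ B(0, R)`, with `R` depending on `r`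
only. -/
def IsLocalMap {Ω : TilingSpace d X} {Ω' : TilingSpace d X'} (φ : C(Ω, Ω')) : Prop :=
  ∀ r : ℝ, 0 < r → ∃ R : ℝ, 0 < R ∧ ∀ T T' : Ω,
    T.1.patch 0 R = T'.1.patch 0 R → (φ T).1.patch 0 r = (φ T').1.patch 0 r

/-- A local derivation: a local map that is also a factor map. -/
def IsLocalDerivation {Ω : TilingSpace d X} {Ω' : TilingSpace d X'} (φ : C(Ω, Ω')) : Prop :=
  IsLocalMap φ ∧ IsFactorMap φ

/-! ### Positions of points as local functions -/

theorem exists_radius (Ω : TilingSpace d X) : ∃ ρ : ℝ, 0 < ρ ∧ ∀ T : Ω,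
    ∀ p ∈ T.1.carrier, ∀ q ∈ T.1.carrier, p ≠ q → 2 * ρ ≤ dist p.1 q.1 := by
  obtain ⟨Λ, hΛ⟩ := Ω.nonempty
  obtain ⟨r, hr, hsep⟩ := Λ.separated
  refine ⟨r / 4, by positivity, fun T p hp q hq hne => ?_⟩
  have hT : T.1 ∈ closure Λ.orbit := (Ω.hull_eq Λ hΛ).symm.subset T.2
  set N := ‖p.1‖ + ‖q.1‖ + 1 with hN
  have hN0 : 0 < N := by positivity
  obtain ⟨δ, hδ0, hδ1, hδ2⟩ : ∃ δ : ℝ, 0 < δ ∧ δ ≤ r / 4 ∧ N ≤ δ⁻¹ := by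
    refine ⟨min (r / 4) N⁻¹, by positivity, min_le_left _ _, ?_⟩
    rw [le_inv_comm₀ (by positivity) (by positivity)]
    exact min_le_right _ _
  obtain ⟨_, ⟨M, a1, a2, a3, -⟩, ⟨x, rfl⟩⟩ :=
    mem_closure_iff_nhds.1 hT _ ((LabeledDelone.hasBasis_nhds T.1).mem_of_mem hδ0)
  obtain ⟨p', hp'⟩ := a3 p hp (by linarith [norm_nonneg q.1])
  obtain ⟨q', hq'⟩ := a3 q hq (by linarith [norm_nonneg p.1])
  have hne' : p' ≠ q' := by
    rintro rfl
    exact hne (a2.1 hp' hq')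
  obtain ⟨-, hp1, hp2⟩ := a1 _ _ hp'
  obtain ⟨-, hq1, hq2⟩ := a1 _ _ hq'
  have h1 := hsep _ hp1 _ hq1 (fun e => hne' (by
    simp only [Prod.mk.injEq, add_left_inj] at e
    exact Prod.ext e.1 e.2))
  simp only [dist_add_right] at h1
  have h2 : dist p.1 p'.1 < δ := (le_max_left _ _).trans_lt hp2
  have h3 : dist q.1 q'.1 < δ := (le_max_left _ _).trans_lt hq2
  have h4 := dist_triangle4 p'.1 p.1 q.1 q'.1
  rw [dist_comm p'.1 p.1] at h4
  linarith

/-- A radius `ρ > 0` such that distinct points of any element of the space are at distance at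
least `2ρ`. -/
noncomputable def radius (Ω : TilingSpace d X) : ℝ := Classical.choose Ω.exists_radius

theorem radius_pos (Ω : TilingSpace d X) : 0 < Ω.radius := (Classical.choose_spec Ω.exists_radius).1

theorem radius_spec (Ω : TilingSpace d X) (T : Ω) {p q : Euc d × X} (hp : p ∈ T.1.carrier)
    (hq : q ∈ T.1.carrier) (h : dist p.1 q.1 < 2 * Ω.radius) : p = q := by
  by_contra hne
  exact absurd ((Classical.choose_spec Ω.exists_radius).2 T p hp q hq hne) (not_le.2 h)

/-- The elements of `Ω` with a (necessarily unique) point in the ball of centre `x` and radius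
`Ω.radius`. -/
def cell (Ω : TilingSpace d X) (x : Euc d) : Set Ω :=
  {T | ∃ p ∈ T.1.carrier, dist p.1 x < Ω.radius}

open Classical in
/-- For `T` in `Ω.cell x`, the position of the point of `T` in the ball of centre `x` and radius
`Ω.radius` (and `0` elsewhere). -/
noncomputable def pos (Ω : TilingSpace d X) (x : Euc d) (T : Ω) : Euc d :=
  if h : T ∈ Ω.cell x then (Classical.choose h).1 else 0

theorem pos_eq (Ω : TilingSpace d X) {x : Euc d} {T : Ω} {p : Euc d × X} (hp : p ∈ T.1.carrier)
    (hx : dist p.1 x < Ω.radius) : Ω.pos x T = p.1 := by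
  have h : T ∈ Ω.cell x := ⟨p, hp, hx⟩
  rw [pos, dif_pos h]
  obtain ⟨h1, h2⟩ := Classical.choose_spec h
  rw [Ω.radius_spec T h1 hp (by linarith [dist_triangle_right (Classical.choose h).1 p.1 x])]

theorem exists_pos (Ω : TilingSpace d X) {x : Euc d} {T : Ω} (h : T ∈ Ω.cell x) :
    ∃ l : X, (Ω.pos x T, l) ∈ T.1.carrier ∧ dist (Ω.pos x T) x < Ω.radius := by
  obtain ⟨p, hp, hx⟩ := h
  rw [Ω.pos_eq hp hx]
  exact ⟨p.2, hp, hx⟩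

theorem exists_cell (Ω : TilingSpace d X) (T : Ω) : ∃ x, T ∈ Ω.cell x := by
  obtain ⟨R, -, h⟩ := T.1.relDense
  obtain ⟨p, hp, -⟩ := h 0
  exact ⟨p.1, p, hp, by simpa using Ω.radius_pos⟩

theorem eventually_pos (Ω : TilingSpace d X) {x : Euc d} {T : Ω} (h : T ∈ Ω.cell x) {ε : ℝ}
    (hε : 0 < ε) : ∀ᶠ T' in 𝓝 T, T' ∈ Ω.cell x ∧ dist (Ω.pos x T') (Ω.pos x T) < ε := by
  obtain ⟨p, hp, hx⟩ := h
  rw [Ω.pos_eq hp hx]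
  have hN0 : 0 < ‖p.1‖ + 1 := by positivity
  have hg : 0 < Ω.radius - dist p.1 x := by linarith
  obtain ⟨δ, hδ0, hδ1, hδ2, hδ3⟩ : ∃ δ : ℝ, 0 < δ ∧ δ ≤ ε ∧ δ ≤ Ω.radius - dist p.1 x ∧
      ‖p.1‖ + 1 ≤ δ⁻¹ := by
    refine ⟨min (min ε (Ω.radius - dist p.1 x)) (‖p.1‖ + 1)⁻¹, ?_, ?_, ?_, ?_⟩
    · exact lt_min (lt_min hε hg) (by positivity)
    · exact (min_le_left _ _).trans (min_le_left _ _)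
    · exact (min_le_left _ _).trans (min_le_right _ _)
    · rw [le_inv_comm₀ (by positivity) (lt_min (lt_min hε hg) (by positivity))]
      exact min_le_right _ _
  have hev : ∀ᶠ T' : Ω in 𝓝 T, LabeledDelone.Near δ T.1 T'.1 :=
    continuous_subtype_val.continuousAt.eventually
      ((LabeledDelone.hasBasis_nhds T.1).mem_of_mem hδ0)
  filter_upwards [hev]
  rintro T' ⟨M, a1, -, a3, -⟩
  obtain ⟨q, hq⟩ := a3 p hp (by linarith)
  obtain ⟨-, hq1, hq2⟩ := a1 _ _ hq
  have h1 : dist p.1 q.1 < δ := (le_max_left _ _).trans_lt hq2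
  have h2 : dist q.1 x < Ω.radius := by
    linarith [dist_triangle_left q.1 x p.1]
  refine ⟨⟨q, hq1, h2⟩, ?_⟩
  rw [Ω.pos_eq hq1 h2, dist_comm]
  linarith

theorem isOpen_cell (Ω : TilingSpace d X) (x : Euc d) : IsOpen (Ω.cell x) :=
  isOpen_iff_mem_nhds.2 fun _ hT => (Ω.eventually_pos hT one_pos).mono fun _ h => h.1

theorem continuousAt_pos (Ω : TilingSpace d X) {x : Euc d} {T : Ω} (h : T ∈ Ω.cell x) :
    ContinuousAt (Ω.pos x) T :=
  Metric.tendsto_nhds.2 fun _ hε => (Ω.eventually_pos h hε).mono fun _ h => h.2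

theorem FLC.eventually_eq {Ω : TilingSpace d X} (hΩ : Ω.FLC) {x y : Euc d} {T : Ω}
    (hx : T ∈ Ω.cell x) (hy : T ∈ Ω.cell y) :
    ∀ᶠ T' in 𝓝 T, Ω.pos x T' - Ω.pos y T' = Ω.pos x T - Ω.pos y T := by
  obtain ⟨F, hF, hP⟩ := hΩ (2 * Ω.radius + dist x y)
  set D : Set (Euc d) := ⋃ P ∈ {P ∈ F | P.Finite}, (fun a : (Euc d × X) × (Euc d × X) =>
    a.1.1 - a.2.1) '' (P ×ˢ P) with hD
  have hDfin : D.Finite :=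
    (hF.subset (Set.sep_subset _ _)).biUnion fun P hP => (hP.2.prod hP.2).image _
  have hmem : ∀ T' : Ω, T' ∈ Ω.cell x → T' ∈ Ω.cell y → Ω.pos x T' - Ω.pos y T' ∈ D := by
    intro T' h1 h2
    obtain ⟨l, hl, hlx⟩ := Ω.exists_pos h1
    obtain ⟨m, hm, hmy⟩ := Ω.exists_pos h2
    obtain ⟨z, hz⟩ := hP T' x
    refine Set.mem_biUnion (x := (fun p : Euc d × X => (p.1 - z, p.2)) ''
      T'.1.patch x (2 * Ω.radius + dist x y))
      ⟨hz, (LabeledDelone.patch_finite _ _ _).image _⟩ ?_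
    refine ⟨((Ω.pos x T' - z, l), (Ω.pos y T' - z, m)), ⟨?_, ?_⟩, by simp⟩
    · exact ⟨(Ω.pos x T', l), ⟨hl, by
        change dist (Ω.pos x T') x < _
        linarith [Ω.radius_pos, dist_nonneg (x := x) (y := y)]⟩, rfl⟩
    · exact ⟨(Ω.pos y T', m), ⟨hm, by
        change dist (Ω.pos y T') x < _
        linarith [Ω.radius_pos, dist_triangle_right (Ω.pos y T') x y]⟩, rfl⟩
  have hcont : ContinuousAt (fun T' => Ω.pos x T' - Ω.pos y T') T :=
    (Ω.continuousAt_pos hx).sub (Ω.continuousAt_pos hy)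
  have hne : ∀ᶠ T' in 𝓝 T, Ω.pos x T' - Ω.pos y T' ∈ (D \ {Ω.pos x T - Ω.pos y T})ᶜ :=
    hcont.eventually ((hDfin.subset Set.sdiff_subset).isClosed.isOpen_compl.mem_nhds (by simp))
  filter_upwards [hne, (Ω.isOpen_cell x).mem_nhds hx, (Ω.isOpen_cell y).mem_nhds hy]
    with T' h1 h2 h3
  by_contra h4
  exact h1 ⟨hmem T' h2 h3, h4⟩

/-! ### Weak cohomology and the weak class of an orbit-preserving map -/

/-- The group of weak dynamical `1`-cocycles with values in `ℝ^d`: continuous functions `α` with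
`α(T, x) + α(T - x, y) = α(T, x + y)`. -/
def weakCocycles (Ω : TilingSpace d X) : AddSubgroup C(Ω × Euc d, Euc d) where
  carrier := {α | ∀ (T : Ω) (x y : Euc d), α (T, x) + α (sub T x, y) = α (T, x + y)}
  zero_mem' := by intro T x y; simp
  add_mem' := by
    intro α β hα hβ T x y
    simp only [ContinuousMap.add_apply]
    rw [← hα T x y, ← hβ T x y]
    abel
  neg_mem' := by
    intro α hα T x y
    simp only [ContinuousMap.neg_apply]
    rw [← hα T x y]
    abel

/-- The coboundary `δs(T, v) = s(T - v) - s(T)` of a continuous function `s`. -/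
def weakCoboundary (Ω : TilingSpace d X) : C(Ω, Euc d) →+ Ω.weakCocycles where
  toFun s := ⟨⟨fun P => s (sub P.1 P.2) - s P.1,
      (s.continuous.comp continuous_sub).sub (s.continuous.comp continuous_fst)⟩, by
    intro T x y
    simp only [ContinuousMap.coe_mk, sub_sub]
    abel⟩
  map_zero' := by ext P; simp
  map_add' s t := by
    apply Subtype.ext
    ext1 P
    simp only [ContinuousMap.coe_mk, ContinuousMap.add_apply, AddSubgroup.coe_add]
    abel

/-- The weak cohomology group `H¹_w(Ω; ℝ^d)`. -/
abbrev WeakH1 (Ω : TilingSpace d X) : Type _ := Ω.weakCocycles ⧸ Ω.weakCoboundary.range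

/-- The function `(T, v) ↦ h_T(v)` of an orbit-preserving map, given by
`h(T - v) = h(T) - h_T(v)`. -/
noncomputable def displacement {Ω : TilingSpace d X} {Ω' : TilingSpace d X'} {h : Ω → Ω'}
    (hh : OrbitPreserving h) (T : Ω) (v : Euc d) : Euc d := Classical.choose (hh T v)

theorem displacement_spec {Ω : TilingSpace d X} {Ω' : TilingSpace d X'} {h : Ω → Ω'}
    (hh : OrbitPreserving h) (T : Ω) (v : Euc d) :
    h (sub T v) = sub (h T) (displacement hh T v) := Classical.choose_spec (hh T v)

theorem displacement_add {Ω : TilingSpace d X} {Ω' : TilingSpace d X'} {h : Ω → Ω'}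
    (hh : OrbitPreserving h) (T : Ω) (x y : Euc d) :
    displacement hh T x + displacement hh (sub T x) y = displacement hh T (x + y) := by
  apply sub_injective (h T)
  rw [← sub_sub, ← displacement_spec hh T x, ← displacement_spec hh (sub T x) y, sub_sub,
    displacement_spec hh T (x + y)]

theorem displacement_zero {Ω : TilingSpace d X} {Ω' : TilingSpace d X'} {h : Ω → Ω'}
    (hh : OrbitPreserving h) (T : Ω) : displacement hh T 0 = 0 := by
  apply sub_injective (h T)
  rw [← displacement_spec hh T 0, sub_zero, sub_zero]

/-- Near `(T₀, v₀)`, the displacement is the negative of the position of a point of `h(T - v)`, up to a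
constant depending on `T`. -/
theorem displacement_local {Ω : TilingSpace d X} {Ω' : TilingSpace d X'} {h : C(Ω, Ω')}
    (hh : OrbitPreserving h) (T₀ : Ω) (v₀ : Euc d) : ∃ x : Euc d, ∃ δ : ℝ, 0 < δ ∧
      h (sub T₀ v₀) ∈ Ω'.cell x ∧ ∀ᶠ T in 𝓝 T₀, ∀ v ∈ Metric.ball v₀ δ,
        h (sub T v) ∈ Ω'.cell x ∧ displacement hh T v =
          displacement hh T v₀ + Ω'.pos x (h (sub T v₀)) - Ω'.pos x (h (sub T v)) := by
  obtain ⟨x, hx⟩ := Ω'.exists_cell (h (sub T₀ v₀))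
  have hc : Continuous fun P : Ω × Euc d => h (sub P.1 P.2) := h.continuous.comp continuous_sub
  have hev : ∀ᶠ P : Ω × Euc d in 𝓝 (T₀, v₀), h (sub P.1 P.2) ∈ Ω'.cell x :=
    hc.continuousAt.eventually ((Ω'.isOpen_cell x).mem_nhds hx)
  rw [nhds_prod_eq] at hev
  obtain ⟨P, hP, Q, hQ, hPQ⟩ := Filter.eventually_prod_iff.1 hev
  obtain ⟨δ, hδ, hball⟩ := Metric.eventually_nhds_iff_ball.1 hQ
  refine ⟨x, δ, hδ, hx, hP.mono fun T hT v hv => ?_⟩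
  have hcell : ∀ w ∈ Metric.ball v₀ δ, h (sub T w) ∈ Ω'.cell x :=
    fun w hw => hPQ hT (hball w hw)
  refine ⟨hcell v hv, ?_⟩
  -- the position, in `h T`, of the chosen point of `h (T - w)`
  let m : Euc d → Euc d := fun w => Ω'.pos x (h (sub T w)) + displacement hh T w
  have hm : ∀ w ∈ Metric.ball v₀ δ, m w ∈ Prod.fst '' (h T).1.carrier := by
    intro w hw
    obtain ⟨l, hl, -⟩ := Ω'.exists_pos (hcell w hw)
    have h1 : (Ω'.pos x (h (sub T w)), l) ∈ (sub (h T) (displacement hh T w)).1.carrier := by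
      rw [← displacement_spec hh T w]
      exact hl
    exact ⟨_, h1, rfl⟩
  let f : Euc d → LabeledDelone d X' := fun w => (h T).1.sub (m w)
  have hf : ∀ w, f w = (h (sub T w)).1.sub (Ω'.pos x (h (sub T w))) := by
    intro w
    rw [displacement_spec hh T w]
    change _ = ((h T).1.sub _).sub _
    rw [LabeledDelone.sub_sub, ← displacement_spec hh T w, add_comm]
  have hfc : ContinuousOn f (Metric.ball v₀ δ) := by
    intro w hw
    apply ContinuousAt.continuousWithinAt
    have e : f = fun w => (h (sub T w)).1.sub (Ω'.pos x (h (sub T w))) := funext hf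
    rw [e]
    have h1 : ContinuousAt (fun w => h (sub T w)) w :=
      (hc.comp (Continuous.prodMk_right T)).continuousAt
    have h2 : ContinuousAt (fun w => Ω'.pos x (h (sub T w))) w :=
      ContinuousAt.comp (f := fun w => h (sub T w)) (Ω'.continuousAt_pos (hcell w hw)) h1
    exact LabeledDelone.continuous_sub.continuousAt.comp
      ((continuous_subtype_val.continuousAt.comp h1).prodMk h2)
  have hcount : (f '' Metric.ball v₀ δ).Countable := by
    refine (((h T).1.countable_carrier.image Prod.fst).image (h T).1.sub).mono ?_
    rintro _ ⟨w, hw, rfl⟩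
    exact ⟨m w, hm w hw, rfl⟩
  have hpre : IsPreconnected (f '' Metric.ball v₀ δ) :=
    (convex_ball v₀ δ).isPreconnected.image f hfc
  have htd : IsTotallyDisconnected (f '' Metric.ball v₀ δ) := by
    rw [← totallyDisconnectedSpace_subtype_iff]
    have : T35Space (LabeledDelone d X') := {}
    have := hcount.totallySeparatedSpace
    infer_instance
  have hsub := htd _ subset_rfl hpre
  have heq : f v = f v₀ := hsub ⟨v, hv, rfl⟩ ⟨v₀, Metric.mem_ball_self hδ, rfl⟩
  have hmm : m v = m v₀ := sub_injective (h T) (Subtype.ext heq)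
  have : Ω'.pos x (h (sub T v)) + displacement hh T v =
    Ω'.pos x (h (sub T v₀)) + displacement hh T v₀ := hmm
  rw [add_comm (displacement hh T v₀), ← this]
  abel

theorem continuous_displacement {Ω : TilingSpace d X} {Ω' : TilingSpace d X'} {h : C(Ω, Ω')}
    (hh : OrbitPreserving h) :
    Continuous fun P : Ω × Euc d => displacement hh P.1 P.2 := by
  have hc : Continuous fun P : Ω × Euc d => h (sub P.1 P.2) := h.continuous.comp continuous_sub
  have hpos : ∀ (x : Euc d) (T : Ω) (v : Euc d), h (sub T v) ∈ Ω'.cell x →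
      ContinuousAt (fun P : Ω × Euc d => Ω'.pos x (h (sub P.1 P.2))) (T, v) := fun x T v hx =>
    ContinuousAt.comp (f := fun P : Ω × Euc d => h (sub P.1 P.2)) (x := (T, v))
      (Ω'.continuousAt_pos hx) hc.continuousAt
  have hpos' : ∀ (x : Euc d) (T : Ω) (v : Euc d), h (sub T v) ∈ Ω'.cell x →
      ContinuousAt (fun T => Ω'.pos x (h (sub T v))) T := fun x T v hx =>
    ContinuousAt.comp (f := fun T : Ω => (T, v)) (x := T) (hpos x T v hx)
      (Continuous.prodMk_left v).continuousAt
  have hT : ∀ (T₀ : Ω) (v : Euc d), ContinuousAt (fun T => displacement hh T v) T₀ := by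
    intro T₀
    let S : Set (Euc d) := {v | ContinuousAt (fun T => displacement hh T v) T₀}
    have hloc : ∀ v₀ : Euc d, ∀ᶠ v in 𝓝 v₀, (v ∈ S ↔ v₀ ∈ S) := by
      intro v₀
      obtain ⟨x, δ, hδ, hx, hev⟩ := displacement_local hh T₀ v₀
      filter_upwards [Metric.ball_mem_nhds v₀ hδ] with v hv
      have hxv : h (sub T₀ v) ∈ Ω'.cell x := (hev.self_of_nhds v hv).1
      constructor
      · intro (hS : ContinuousAt (fun T => displacement hh T v) T₀)
        change ContinuousAt (fun T => displacement hh T v₀) T₀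
        have : ContinuousAt (fun T => displacement hh T v - Ω'.pos x (h (sub T v₀)) +
          Ω'.pos x (h (sub T v))) T₀ := (hS.sub (hpos' _ _ _ hx)).add (hpos' _ _ _ hxv)
        refine this.congr (hev.mono fun T hT => ?_)
        simp only [(hT v hv).2]
        abel
      · intro (hS : ContinuousAt (fun T => displacement hh T v₀) T₀)
        change ContinuousAt (fun T => displacement hh T v) T₀
        have : ContinuousAt (fun T => displacement hh T v₀ + Ω'.pos x (h (sub T v₀)) -
          Ω'.pos x (h (sub T v))) T₀ := (hS.add (hpos' _ _ _ hx)).sub (hpos' _ _ _ hxv)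
        exact this.congr (hev.mono fun T hT => ((hT v hv).2).symm)
    have hclopen : IsClopen S := by
      constructor
      · rw [← isOpen_compl_iff, isOpen_iff_mem_nhds]
        intro v hv
        filter_upwards [hloc v] with w hw
        exact fun h => hv (hw.1 h)
      · rw [isOpen_iff_mem_nhds]
        intro v hv
        filter_upwards [hloc v] with w hw
        exact hw.2 hv
    have h0 : (0 : Euc d) ∈ S := by
      change ContinuousAt (fun T => displacement hh T 0) T₀
      simp only [displacement_zero]
      exact continuousAt_const
    have : S = Set.univ := hclopen.eq_univ ⟨0, h0⟩
    intro v
    exact (this ▸ Set.mem_univ v : v ∈ S)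
  rw [continuous_iff_continuousAt]
  rintro ⟨T₀, v₀⟩
  obtain ⟨x, δ, hδ, hx, hev⟩ := displacement_local hh T₀ v₀
  have h1 : ContinuousAt (fun P : Ω × Euc d => displacement hh P.1 v₀ +
      Ω'.pos x (h (sub P.1 v₀)) - Ω'.pos x (h (sub P.1 P.2))) (T₀, v₀) :=
    ((ContinuousAt.comp (f := Prod.fst) (x := (T₀, v₀)) (hT T₀ v₀) continuous_fst.continuousAt).add
      (ContinuousAt.comp (f := Prod.fst) (x := (T₀, v₀)) (hpos' x T₀ v₀ hx)
        continuous_fst.continuousAt)).sub (hpos x T₀ v₀ hx)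
  refine h1.congr ?_
  rw [nhds_prod_eq]
  filter_upwards [hev.prod_mk (Metric.ball_mem_nhds v₀ hδ)] with P hP
  exact ((hP.1 P.2 hP.2).2).symm

/-- The weak class `[h]_w ∈ H¹_w(Ω; ℝ^d)` of an orbit-preserving continuous map `h`: the class of
the cocycle `(T, v) ↦ h_T(v)`. -/
noncomputable def weakClass {Ω : TilingSpace d X} {Ω' : TilingSpace d X'} (h : C(Ω, Ω'))
    (hh : OrbitPreserving h) : Ω.WeakH1 :=
  QuotientAddGroup.mk
    ⟨⟨fun P => displacement hh P.1 P.2, continuous_displacement hh⟩, displacement_add hh⟩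

end TilingSpace

universe u v w t

/-! ### First Čech cohomology with constant coefficients, and the strong class of a map -/

/-- A Čech `1`-cocycle on `Y` with values in the (discrete) group `A`: an open cover `(U i)` and
locally constant functions `g i j` on `U i ∩ U j` (the values elsewhere play no role) with
`g i j + g j k = g i k` on triple intersections. -/
structure CechCocycle (Y : Type u) [TopologicalSpace Y] (A : Type v) [AddCommGroup A] where
  ι : Type w
  U : ι → Set Y
  isOpen : ∀ i, IsOpen (U i)
  cover : ∀ y, ∃ i, y ∈ U i
  g : ι → ι → Y → A
  locConst : ∀ i j, ∀ y, y ∈ U i → y ∈ U j → ∀ᶠ z in 𝓝 y, g i j z = g i j y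
  cocycle : ∀ i j k, ∀ y, y ∈ U i → y ∈ U j → y ∈ U k → g i j y + g j k y = g i k y

namespace CechCocycle

variable {Y : Type u} [TopologicalSpace Y] {A : Type v} [AddCommGroup A]

/-- Two Čech cocycles have the same image in the direct limit over all open covers: on some common
refinement `(V k)` of their covers (with refinement maps `a`, `b`) they differ by the coboundary of
a family of locally constant functions `s k` on `V k`. It suffices to consider refinements indexed
by the points of `Y`, with `k ∈ V k`, since each refinement has a refinement of this form. -/
def Cohomologous (c c' : CechCocycle.{u, v, w} Y A) : Prop :=
  ∃ (V : Y → Set Y) (a : Y → c.ι) (b : Y → c'.ι) (s : Y → Y → A),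
    (∀ k, IsOpen (V k) ∧ k ∈ V k ∧ V k ⊆ c.U (a k) ∧ V k ⊆ c'.U (b k)) ∧
    (∀ k, ∀ y ∈ V k, ∀ᶠ z in 𝓝 y, s k z = s k y) ∧
    ∀ k l, ∀ y, y ∈ V k → y ∈ V l →
      c.g (a k) (a l) y - c'.g (b k) (b l) y = s l y - s k y

theorem Cohomologous.refl (c : CechCocycle.{u, v, w} Y A) : Cohomologous c c := by
  choose i hi using c.cover
  exact ⟨fun k => c.U (i k), i, i, fun _ _ => 0,
    fun k => ⟨c.isOpen _, hi k, subset_rfl, subset_rfl⟩, by simp, by simp⟩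

theorem Cohomologous.symm {c c' : CechCocycle.{u, v, w} Y A} (h : Cohomologous c c') :
    Cohomologous c' c := by
  obtain ⟨V, a, b, s, h1, h2, h3⟩ := h
  refine ⟨V, b, a, fun k y => -s k y, fun k => ⟨(h1 k).1, (h1 k).2.1, (h1 k).2.2.2, (h1 k).2.2.1⟩,
    fun k y hy => (h2 k y hy).mono fun z hz => congrArg Neg.neg hz, fun k l y hk hl => ?_⟩
  beta_reduce
  rw [← neg_sub, h3 k l y hk hl]
  abel

theorem Cohomologous.trans {c c' c'' : CechCocycle.{u, v, w} Y A} (h : Cohomologous c c')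
    (h' : Cohomologous c' c'') : Cohomologous c c'' := by
  obtain ⟨V, a, b, s, h1, h2, h3⟩ := h
  obtain ⟨V', a', b', s', h1', h2', h3'⟩ := h'
  refine ⟨fun k => V k ∩ V' k, a, b', fun k y => s k y + s' k y + c'.g (a' k) (b k) y,
    fun k => ⟨(h1 k).1.inter (h1' k).1, ⟨(h1 k).2.1, (h1' k).2.1⟩,
      Set.inter_subset_left.trans (h1 k).2.2.1, Set.inter_subset_right.trans (h1' k).2.2.2⟩,
    fun k y hy => ?_, fun k l y hk hl => ?_⟩
  · filter_upwards [h2 k y hy.1, h2' k y hy.2,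
      c'.locConst _ _ y ((h1' k).2.2.1 hy.2) ((h1 k).2.2.2 hy.1)] with z e1 e2 e3
    rw [e1, e2, e3]
  · have e1 := h3 k l y hk.1 hl.1
    have e2 := h3' k l y hk.2 hl.2
    have mbk := (h1 k).2.2.2 hk.1
    have mbl := (h1 l).2.2.2 hl.1
    have mak := (h1' k).2.2.1 hk.2
    have mal := (h1' l).2.2.1 hl.2
    have e3 := c'.cocycle _ _ _ y mak mbk mbl
    have e4 := c'.cocycle _ _ _ y mak mal mbl
    have e5 : c.g (a k) (a l) y = s l y - s k y + c'.g (b k) (b l) y := by rw [← e1]; abel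
    have e6 : c''.g (b' k) (b' l) y = c'.g (a' k) (a' l) y - (s' l y - s' k y) := by
      rw [← e2]; abel
    have e7 : c'.g (b k) (b l) y =
        c'.g (a' k) (a' l) y + c'.g (a' l) (b l) y - c'.g (a' k) (b k) y := by
      rw [e4, ← e3]; abel
    beta_reduce
    rw [e5, e6, e7]
    abel

/-- The relation of being cohomologous, as an equivalence relation. -/
def setoid (Y : Type u) [TopologicalSpace Y] (A : Type v) [AddCommGroup A] :
    Setoid (CechCocycle.{u, v, w} Y A) :=
  ⟨Cohomologous, Cohomologous.refl, Cohomologous.symm, Cohomologous.trans⟩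

/-- The pullback of a Čech cocycle along a continuous map. -/
def pullback {Z : Type t} [TopologicalSpace Z] (f : C(Y, Z)) (c : CechCocycle.{t, v, w} Z A) :
    CechCocycle.{u, v, w} Y A where
  ι := c.ι
  U i := f ⁻¹' c.U i
  isOpen i := (c.isOpen i).preimage f.continuous
  cover y := c.cover (f y)
  g i j y := c.g i j (f y)
  locConst i j y hi hj := f.continuous.continuousAt.eventually (c.locConst i j (f y) hi hj)
  cocycle i j k y hi hj hk := c.cocycle i j k (f y) hi hj hk

theorem Cohomologous.pullback {Z : Type t} [TopologicalSpace Z] (f : C(Y, Z))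
    {c c' : CechCocycle.{t, v, w} Z A} (h : Cohomologous c c') :
    Cohomologous (c.pullback f) (c'.pullback f) := by
  obtain ⟨V, a, b, s, h1, h2, h3⟩ := h
  exact ⟨fun k => f ⁻¹' V (f k), fun k => a (f k), fun k => b (f k), fun k y => s (f k) (f y),
    fun k => ⟨(h1 _).1.preimage f.continuous, (h1 _).2.1, Set.preimage_mono (h1 _).2.2.1,
      Set.preimage_mono (h1 _).2.2.2⟩,
    fun k y hy => f.continuous.continuousAt.eventually (h2 _ (f y) hy),
    fun k l y hk hl => h3 _ _ (f y) hk hl⟩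

end CechCocycle

/-- The first Čech cohomology of `Y` with coefficients in `A`. -/
def CechH1 (Y : Type u) [TopologicalSpace Y] (A : Type v) [AddCommGroup A] : Type (max u v (w + 1)) :=
  Quotient (CechCocycle.setoid.{u, v, w} Y A)

/-- The map `f^*` induced by a continuous map `f` on Čech cohomology. -/
def CechH1.map {Y : Type u} {Z : Type t} [TopologicalSpace Y] [TopologicalSpace Z] {A : Type v}
    [AddCommGroup A] (f : C(Y, Z)) : CechH1.{t, v, w} Z A → CechH1.{u, v, w} Y A :=
  Quotient.map (CechCocycle.pullback f) fun _ _ h => h.pullback f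

namespace TilingSpace

variable {d : ℕ} {X : Type u} {X' : Type t} [MetricSpace X] [MetricSpace X']

/-- The fundamental shape class, as a Čech cocycle on an FLC tiling space. On `cell x`, the cocycle
`(T, v) ↦ v` has the transversally locally constant primitive `T ↦ -pos x T` (that is, minus the
position of a point of `T`; it changes by `v` when `T` is replaced by `T - v`, `v` small), and
`g x y` is the difference of the primitives on `cell y` and `cell x`: the displacement from the
point of `T` near `y` to the point of `T` near `x`. -/
noncomputable def shapeCocycle (Ω : TilingSpace d X) (hΩ : Ω.FLC) : CechCocycle.{u, 0, 0} Ω (Euc d) where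
  ι := Euc d
  U x := Ω.cell x
  isOpen x := Ω.isOpen_cell x
  cover T := Ω.exists_cell T
  g x y T := Ω.pos x T - Ω.pos y T
  locConst _ _ _ hx hy := hΩ.eventually_eq hx hy
  cocycle _ _ _ _ _ _ _ := sub_add_sub_cancel _ _ _

/-- The fundamental shape class `[F(Ω)]` of an FLC tiling space in Čech cohomology. -/
noncomputable def shapeClass (Ω : TilingSpace d X) (hΩ : Ω.FLC) : CechH1.{u, 0, 0} Ω (Euc d) :=
  Quotient.mk (CechCocycle.setoid.{u, 0, 0} Ω (Euc d)) (Ω.shapeCocycle hΩ)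

/-- The strong class `[h]_s = h^*[F(Ω')]` of a continuous map `h` between FLC tiling spaces. -/
noncomputable def strongClass {Ω : TilingSpace d X} {Ω' : TilingSpace d X'} (h : C(Ω, Ω'))
    (hΩ' : Ω'.FLC) : CechH1.{u, 0, 0} Ω (Euc d) :=
  CechH1.map h (Ω'.shapeClass hΩ')

end TilingSpace

/-! Suppose a continuous `s : Ω → ℝ^d` has as coboundary the difference of the displacement cocycles
of `h₁` and `h₂`. Then `T ↦ h₂ T - s T` has the same displacement cocycle as `h₁`. Since `h₁` is
invertible and identifies orbits with orbits, composing this map with `h₁⁻¹` cancels the time change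
and leaves a map `φ` that commutes with translations. Scaling `s` by a parameter in `[0, 1]` gives
the homotopy (`exists_factorMap`). Equality of weak classes is precisely the existence of such an
`s`.

Equality of strong classes gives more (`exists_of_strongClass_eq`). The Čech coboundary relation
glues the local functions (position of a point of `h₂ T`) - (position of a point of `h₁ T`) -
(locally constant function) into a global `s`. Positions change by minus the displacement under
small translations, so `s` has the required coboundary for small vectors, and for all vectors
because `ℝ^d` is connected.

With this `s`, locally `φ (h₁ T)` is `h₂ T` recentred at one of its points, then translated by a
vector read off from one point of `h₁ T`. By FLC the recentred patch of `h₂ T` is locally constant,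
and the vector is determined by a patch of `h₁ T` (`isLocalMap_of_eventually_eq`). Compactness of
`Ω₁` makes the radius uniform (`isLocalMap_of_eventually`). -/

namespace TilingSpace

/-! ### Factor maps from cohomologous displacement cocycles -/

variable {d : ℕ} {X X₁ X₂ : Type*} [MetricSpace X] [MetricSpace X₁] [MetricSpace X₂]
  {Ω : TilingSpace d X} {Ω₁ : TilingSpace d X₁} {Ω₂ : TilingSpace d X₂}

/-- If the cocycles of an orbit equivalence `h₁` and of an orbit-preserving map `h₂` differ by the
coboundary of `s`, then `h₁ T ↦ h₂ T - s T` is a factor map, and it is homotopic to `h₂` along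
`T ↦ h₂ T - t • s T`. -/
theorem exists_factorMap {h₁ : Ω ≃ₜ Ω₁} (hh₁ : IsOrbitEquivalence h₁) {h₂ : C(Ω, Ω₂)}
    (hh₂ : OrbitPreserving h₂) (s : C(Ω, Euc d))
    (hs : ∀ T v, s (sub T v) - s T =
      displacement hh₁.orbitPreserving T v - displacement hh₂ T v) :
    ∃ φ : C(Ω₁, Ω₂), IsFactorMap φ ∧ ContinuousMap.Homotopic h₂ (φ.comp (h₁ : C(Ω, Ω₁))) ∧
      ∀ T, φ (h₁ T) = sub (h₂ T) (s T) := by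
  let g : C(Ω, Ω₂) := ⟨fun T => sub (h₂ T) (s T),
    continuous_sub.comp (h₂.continuous.prodMk s.continuous)⟩
  -- Subtracting `s` exchanges the displacement cocycle of `h₂` for that of `h₁`.
  have hg : ∀ T v, g (sub T v) = sub (g T) (displacement hh₁.orbitPreserving T v) := by
    intro T v
    change sub (h₂ (sub T v)) (s (sub T v)) = sub (sub (h₂ T) (s T)) _
    rw [displacement_spec hh₂, sub_sub, sub_sub]
    congr 1
    have := hs T v
    rw [sub_eq_sub_iff_add_eq_add] at this
    rw [add_comm, this, add_comm]
  refine ⟨g.comp (h₁.symm : C(Ω₁, Ω)), ?_, ?_, fun T => ?_⟩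
  · intro T' x
    obtain ⟨T, rfl⟩ := h₁.surjective T'
    obtain ⟨T'', hT''⟩ := h₁.surjective (sub (h₁ T) x)
    -- This is where `h₁` must reflect orbits: every translate of `h₁ T` comes from a translate of
    -- `T`. Aperiodicity then identifies `x` with the displacement.
    obtain ⟨v, rfl⟩ := (hh₁ T T'').2 ⟨x, hT''⟩
    have hx : displacement hh₁.orbitPreserving T v = x :=
      sub_injective (h₁ T) ((displacement_spec hh₁.orbitPreserving T v).symm.trans hT'')
    change g (h₁.symm (sub (h₁ T) x)) = sub (g (h₁.symm (h₁ T))) x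
    rw [← hT'', h₁.symm_apply_apply, h₁.symm_apply_apply, hg, hx]
  · refine ⟨⟨⟨fun P => sub (h₂ P.2) ((P.1 : ℝ) • s P.2), ?_⟩, fun T => ?_, fun T => ?_⟩⟩
    · exact continuous_sub.comp ((h₂.continuous.comp continuous_snd).prodMk
        ((continuous_subtype_val.comp continuous_fst).smul (s.continuous.comp continuous_snd)))
    · simp [sub_zero]
    · simp [g]
  · simp [g]

/-- Equality of weak classes, spelled out. -/
theorem exists_of_weakClass_eq {h₁ : C(Ω, Ω₁)} {hh₁ : OrbitPreserving h₁} {h₂ : C(Ω, Ω₂)}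
    {hh₂ : OrbitPreserving h₂} (h : weakClass h₁ hh₁ = weakClass h₂ hh₂) :
    ∃ s : C(Ω, Euc d), ∀ T v, s (sub T v) - s T = displacement hh₁ T v - displacement hh₂ T v := by
  obtain ⟨s, hs⟩ := QuotientAddGroup.eq.1 h
  -- Equality in the quotient is expressed by `-a + b`, hence the change of sign.
  refine ⟨-s, fun T v => ?_⟩
  have h1 : s (sub T v) - s T = -displacement hh₁ T v + displacement hh₂ T v :=
    congrArg (fun α : Ω.weakCocycles => α.1 (T, v)) hs
  rw [ContinuousMap.neg_apply, ContinuousMap.neg_apply, neg_sub_neg, ← neg_sub, h1]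
  abel

/-! ### Transfer functions from equal strong classes -/

/-- If the coboundary of `s` agrees with the cocycle `α` for small translations, then it agrees
with `α` everywhere. -/
theorem sub_eq_of_eventually {α : Ω → Euc d → Euc d} {s : Ω → Euc d}
    (hα : ∀ T x y, α T x + α (sub T x) y = α T (x + y))
    (hs : ∀ T, ∀ᶠ v in 𝓝 (0 : Euc d), s (sub T v) - s T = α T v) (T : Ω) (v : Euc d) :
    s (sub T v) - s T = α T v := by
  let f : Euc d → Euc d := fun v => s (sub T v) - s T - α T v
  -- By the cocycle identity based at `T - x`, the variation of `f` near `x` reduces to the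
  -- hypothesis near `0`; a locally constant function on the connected space `ℝ^d` is constant.
  have hf : IsLocallyConstant f := by
    rw [IsLocallyConstant.iff_eventually_eq]
    intro x
    have hc : Filter.Tendsto (fun y => y - x) (𝓝 x) (𝓝 (0 : Euc d)) := by
      simpa using (continuous_id.sub continuous_const).tendsto (f := fun y : Euc d => y - x) x
    filter_upwards [hc.eventually (hs (sub T x))] with y hy
    have h1 := hα T x (y - x)
    rw [sub_sub, add_sub_cancel] at hy
    rw [add_sub_cancel] at h1
    change s (sub T y) - s T - α T y = s (sub T x) - s T - α T x
    rw [← h1, ← hy]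
    abel
  have h0 : f 0 = 0 := by
    have h1 := (hs T).self_of_nhds
    change s (sub T 0) - s T - α T 0 = 0
    rw [h1, sub_self]
  exact sub_eq_zero.1 ((hf.apply_eq_of_preconnectedSpace v 0).trans h0)

/-- Along an orbit, the position of a point of `h T` changes by minus the displacement. -/
theorem eventually_displacement {h : C(Ω, Ω₁)} (hh : OrbitPreserving h) {x : Euc d} {T : Ω}
    (hx : h T ∈ Ω₁.cell x) :
    ∀ᶠ v in 𝓝 (0 : Euc d), Ω₁.pos x (h (sub T v)) = Ω₁.pos x (h T) - displacement hh T v := by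
  obtain ⟨l, hl, hlx⟩ := Ω₁.exists_pos hx
  have hc : Continuous fun v => displacement hh T v :=
    (continuous_displacement hh).comp (Continuous.prodMk_right T)
  -- The chosen point of `h T` sits in `h (T - v)` at its old position minus the displacement. For
  -- small `v` it is still in the ball around `x`, so it is the point selected by `pos`.
  have hd : ∀ᶠ v in 𝓝 (0 : Euc d),
      dist (Ω₁.pos x (h T) - displacement hh T v) x < Ω₁.radius := by
    have : Continuous fun v => dist (Ω₁.pos x (h T) - displacement hh T v) x :=
      (continuous_const.sub hc).dist continuous_const
    refine this.continuousAt.eventually_lt continuousAt_const ?_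
    rw [displacement_zero, _root_.sub_zero]
    exact hlx
  filter_upwards [hd] with v hv
  refine Ω₁.pos_eq (p := (Ω₁.pos x (h T) - displacement hh T v, l)) ?_ hv
  rw [displacement_spec hh T v]
  change (_ + displacement hh T v, l) ∈ (h T).1.carrier
  rwa [sub_add_cancel]

/-- If two strong classes coincide, then the cocycles of the maps differ by the coboundary of a
continuous function, which is locally the difference of the positions of points of the images, up
to a locally constant function. -/
theorem exists_of_strongClass_eq {h₁ : C(Ω, Ω₁)} {F₁ : Ω₁.FLC} {h₂ : C(Ω, Ω₂)} {F₂ : Ω₂.FLC}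
    (hh₁ : OrbitPreserving h₁) (hh₂ : OrbitPreserving h₂)
    (h : strongClass h₁ F₁ = strongClass h₂ F₂) :
    ∃ s : C(Ω, Euc d),
      (∀ T v, s (sub T v) - s T = displacement hh₁ T v - displacement hh₂ T v) ∧
      ∀ T₀, ∃ x y c, h₁ T₀ ∈ Ω₁.cell x ∧ h₂ T₀ ∈ Ω₂.cell y ∧
        ∀ᶠ T in 𝓝 T₀, s T = Ω₂.pos y (h₂ T) - Ω₁.pos x (h₁ T) + c := by
  obtain ⟨V, a, b, t, hV, ht, heq⟩ := Quotient.exact h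
  let a' : Ω → Euc d := a
  let b' : Ω → Euc d := b
  have ha : ∀ k, ∀ T ∈ V k, h₁ T ∈ Ω₁.cell (a' k) := fun k T hT => (hV k).2.2.1 hT
  have hb : ∀ k, ∀ T ∈ V k, h₂ T ∈ Ω₂.cell (b' k) := fun k T hT => (hV k).2.2.2 hT
  let f : Ω → Ω → Euc d := fun k T => Ω₂.pos (b' k) (h₂ T) - Ω₁.pos (a' k) (h₁ T) - t k T
  -- The coboundary relation, rearranged, says that the `f k` agree on overlaps, so the diagonal `T
  -- ↦ f T T` is their gluing.
  have hf : ∀ k T, T ∈ V k → f T T = f k T := by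
    intro k T hT
    have h1 : Ω₁.pos (a' k) (h₁ T) - Ω₁.pos (a' T) (h₁ T) -
        (Ω₂.pos (b' k) (h₂ T) - Ω₂.pos (b' T) (h₂ T)) = t T T - t k T :=
      heq k T T hT (hV T).2.1
    change _ - _ - t T T = _ - _ - t k T
    have h2 : t T T = t k T + (Ω₁.pos (a' k) (h₁ T) - Ω₁.pos (a' T) (h₁ T) -
        (Ω₂.pos (b' k) (h₂ T) - Ω₂.pos (b' T) (h₂ T))) := by rw [h1]; abel
    rw [h2]
    abel
  -- Near `T₀` the index can be frozen at `T₀`, and `t T₀` is then constant.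
  have hloc : ∀ T₀, ∀ᶠ T in 𝓝 T₀, f T T =
      Ω₂.pos (b' T₀) (h₂ T) - Ω₁.pos (a' T₀) (h₁ T) + -t T₀ T₀ := by
    intro T₀
    filter_upwards [(hV T₀).1.mem_nhds (hV T₀).2.1, ht T₀ T₀ (hV T₀).2.1] with T h1 h2
    rw [hf T₀ T h1, ← h2]
    exact sub_eq_add_neg _ _
  have hcont : Continuous fun T => f T T := by
    rw [continuous_iff_continuousAt]
    intro T₀
    refine ContinuousAt.congr ?_ ((hloc T₀).mono fun T hT => hT.symm)
    exact ((ContinuousAt.comp (f := h₂) (Ω₂.continuousAt_pos (hb T₀ T₀ (hV T₀).2.1))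
      h₂.continuous.continuousAt).sub (ContinuousAt.comp (f := h₁)
      (Ω₁.continuousAt_pos (ha T₀ T₀ (hV T₀).2.1)) h₁.continuous.continuousAt)).add
      continuousAt_const
  refine ⟨⟨fun T => f T T, hcont⟩, ?_, fun T₀ => ⟨a' T₀, b' T₀, -t T₀ T₀,
    ha T₀ T₀ (hV T₀).2.1, hb T₀ T₀ (hV T₀).2.1, hloc T₀⟩⟩
  refine sub_eq_of_eventually (s := fun T => f T T)
    (α := fun T v => displacement hh₁ T v - displacement hh₂ T v) ?_ ?_
  · intro T x y
    rw [← displacement_add hh₁, ← displacement_add hh₂]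
    abel
  · intro T
    have hc : Filter.Tendsto (fun v => sub T v) (𝓝 (0 : Euc d)) (𝓝 T) := by
      have := (continuous_sub.comp (Continuous.prodMk_right T)).tendsto (0 : Euc d)
      simpa [sub_zero, Function.comp_def] using this
    filter_upwards [hc.eventually (hloc T), eventually_displacement hh₁ (ha T T (hV T).2.1),
      eventually_displacement hh₂ (hb T T (hV T).2.1)] with v h1 h2 h3
    rw [h1, h2, h3, (hloc T).self_of_nhds]
    abel

end TilingSpace

/-! ### Patches and the topology -/

namespace LabeledDelone

variable {d : ℕ} {X : Type*}

theorem mem_patch_sub {Λ : LabeledDelone d X} {x : Euc d} {r : ℝ} {p : Euc d × X} :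
    p ∈ (Λ.sub x).patch 0 r ↔ (p.1 + x, p.2) ∈ Λ.patch x r := by
  simp [patch, mem_sub, dist_eq_norm]

theorem mem_patch_zero {Λ : LabeledDelone d X} {r : ℝ} {p : Euc d × X} :
    p ∈ Λ.patch 0 r ↔ p ∈ Λ.carrier ∧ ‖p.1‖ < r := by
  simp [patch]

theorem patch_mono_of_eq {Λ Λ' : LabeledDelone d X} {r R : ℝ} (hr : r ≤ R)
    (h : Λ.patch 0 R = Λ'.patch 0 R) : Λ.patch 0 r = Λ'.patch 0 r := by
  have key : ∀ Λ Λ' : LabeledDelone d X, Λ.patch 0 R = Λ'.patch 0 R →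
      Λ.patch 0 r ⊆ Λ'.patch 0 r := fun Λ Λ' h p hp =>
    ⟨(h.subset (show p ∈ Λ.patch 0 R from ⟨hp.1, hp.2.trans_le hr⟩)).1, hp.2⟩
  exact Set.Subset.antisymm (key _ _ h) (key _ _ h.symm)

/-- A large patch around the origin determines the smaller patches of translates. -/
theorem patch_sub_eq {Λ Λ' : LabeledDelone d X} {w : Euc d} {r R : ℝ} (hr : r + ‖w‖ ≤ R)
    (h : Λ.patch 0 R = Λ'.patch 0 R) : (Λ.sub w).patch 0 r = (Λ'.sub w).patch 0 r := by
  have key : ∀ Λ Λ' : LabeledDelone d X, Λ.patch 0 R = Λ'.patch 0 R →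
      (Λ.sub w).patch 0 r ⊆ (Λ'.sub w).patch 0 r := by
    intro Λ Λ' h p hp
    rw [mem_patch_zero] at hp ⊢
    refine ⟨(h.subset (show (p.1 + w, p.2) ∈ Λ.patch 0 R from
      mem_patch_zero.2 ⟨hp.1, ?_⟩)).1, hp.2⟩
    exact (norm_add_le p.1 w).trans_lt (by linarith [hp.2])
  exact Set.Subset.antisymm (key _ _ h) (key _ _ h.symm)

variable [MetricSpace X]

/-- The identity matching on the common patch suffices. This turns agreement of patches into
membership in an entourage. -/
theorem near_of_patch_eq {Λ Λ' : LabeledDelone d X} {ε R : ℝ} (hε : 0 < ε) (hR : ε⁻¹ ≤ R)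
    (h : Λ.patch 0 R = Λ'.patch 0 R) : Near ε Λ Λ' := by
  refine ⟨fun p q => p = q ∧ p ∈ Λ.patch 0 R, ?_, ⟨?_, ?_⟩, fun p hp hn => ⟨p, rfl, ?_⟩,
    fun q hq hn => ⟨q, rfl, ?_⟩⟩
  · rintro p q ⟨rfl, hp⟩
    exact ⟨hp.1, (h ▸ hp : p ∈ Λ'.patch 0 R).1, by simpa using hε⟩
  · rintro p q s ⟨rfl, -⟩ ⟨rfl, -⟩; rfl
  · rintro p q s ⟨rfl, -⟩ ⟨rfl, -⟩; rfl
  · exact mem_patch_zero.2 ⟨hp, hn.trans_le hR⟩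
  · rw [h]; exact mem_patch_zero.2 ⟨hq, hn.trans_le hR⟩

theorem hasBasis_uniformity : (uniformity (LabeledDelone d X)).HasBasis (fun ε : ℝ => 0 < ε)
    (fun ε => {P | Near ε P.1 P.2}) := by
  refine ⟨fun t => ?_⟩
  change t ∈ (nearBasis d X).filter ↔ _
  rw [FilterBasis.mem_filter_iff]
  constructor
  · rintro ⟨_, ⟨ε, hε, rfl⟩, h⟩; exact ⟨ε, hε, h⟩
  · rintro ⟨ε, hε, h⟩; exact ⟨_, ⟨ε, hε, rfl⟩, h⟩

/-- If the large patches of `Λ'` near `Λ` only contain points of a finite set, then `Λ'` has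
the same patch as `Λ`. -/
theorem eventually_patch_eq {Λ : LabeledDelone d X} {D : Set (Euc d × X)} (hD : D.Finite) {r : ℝ}
    (hΛ : Λ.patch 0 (r + 1) ⊆ D) :
    ∀ᶠ Λ' in 𝓝 Λ, Λ'.patch 0 (r + 1) ⊆ D → Λ'.patch 0 r = Λ.patch 0 r := by
  -- A finite set is uniformly separated, labels included: matched points of `D` closer than `η` are
  -- equal.
  obtain ⟨η, hη, hsep⟩ : ∃ η : ℝ, 0 < η ∧ ∀ p ∈ D, ∀ q ∈ D, dist p q < η → p = q := by
    have hpos : ∀ P ∈ D ×ˢ D, ∃ η : ℝ, 0 < η ∧ (dist P.1 P.2 < η → P.1 = P.2) := by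
      rintro P -
      by_cases h : P.1 = P.2
      · exact ⟨1, one_pos, fun _ => h⟩
      · exact ⟨dist P.1 P.2, dist_pos.2 h, fun h' => absurd h' (lt_irrefl _)⟩
    have hev : ∀ᶠ η : ℝ in 𝓝[>] 0, ∀ P ∈ D ×ˢ D, dist P.1 P.2 < η → P.1 = P.2 := by
      rw [Filter.eventually_all_finite (hD.prod hD)]
      intro P hP
      obtain ⟨η, hη, h⟩ := hpos P hP
      filter_upwards [Ioo_mem_nhdsGT hη] with θ hθ hd
      exact h (hd.trans hθ.2)
    obtain ⟨η, h1, h2⟩ := (hev.and self_mem_nhdsWithin).exists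
    exact ⟨η, h2, fun p hp q hq => h1 (p, q) ⟨hp, hq⟩⟩
  have hN : 0 < |r| + 1 := by positivity
  -- `ε ≤ η` forces matched points to coincide, `ε ≤ 1` keeps the partner of a point of norm `< r`
  -- within `r + 1`, and the bound on `ε⁻¹` ensures that such a point is matched. The absolute value
  -- allows for negative `r`.
  obtain ⟨ε, h0, h1, h2, h3⟩ : ∃ ε : ℝ, 0 < ε ∧ ε ≤ η ∧ ε ≤ 1 ∧ |r| + 1 ≤ ε⁻¹ := by
    refine ⟨min (min η 1) (|r| + 1)⁻¹, by positivity, (min_le_left _ _).trans (min_le_left _ _),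
      (min_le_left _ _).trans (min_le_right _ _), ?_⟩
    rw [le_inv_comm₀ (by positivity) (by positivity)]
    exact min_le_right _ _
  have hr : r < ε⁻¹ := by linarith [le_abs_self r]
  filter_upwards [(hasBasis_nhds Λ).mem_of_mem h0] with Λ' hN hΛ'
  have key : ∀ Λ Λ' : LabeledDelone d X, Λ.patch 0 (r + 1) ⊆ D → Λ'.patch 0 (r + 1) ⊆ D →
      Near ε Λ Λ' → Λ.patch 0 r ⊆ Λ'.patch 0 r := by
    rintro Λ Λ' hΛ hΛ' ⟨M, a1, -, a3, -⟩ p hp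
    rw [mem_patch_zero] at hp
    obtain ⟨q, hq⟩ := a3 p hp.1 (hp.2.trans hr)
    obtain ⟨-, b1, b2⟩ := a1 p q hq
    have hd : dist p.1 q.1 < ε := (le_max_left _ _).trans_lt b2
    have hq' : ‖q.1‖ < r + 1 := by
      rw [dist_comm, dist_eq_norm] at hd
      linarith [norm_sub_norm_le q.1 p.1]
    have : p = q := hsep p (hΛ (mem_patch_zero.2 ⟨hp.1, by linarith⟩)) q
      (hΛ' (mem_patch_zero.2 ⟨b1, hq'⟩)) (b2.trans_le h1)
    exact mem_patch_zero.2 ⟨this ▸ b1, hp.2⟩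
  exact Set.Subset.antisymm (key _ _ hΛ' hΛ hN.symm) (key _ _ hΛ hΛ' hN)

end LabeledDelone

namespace TilingSpace

variable {d : ℕ} {X : Type*} [MetricSpace X]

/-! ### Compactness of tiling spaces -/

/-- The elements of a tiling space are relatively dense with a common radius. -/
theorem exists_covering_radius (Ω : TilingSpace d X) : ∃ R : ℝ, 0 < R ∧ ∀ (T : Ω) (x : Euc d),
    ∃ p ∈ T.1.carrier, dist p.1 x ≤ R := by
  obtain ⟨Λ, hΛ⟩ := Ω.nonempty
  obtain ⟨R, hR, hd⟩ := Λ.relDense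
  refine ⟨R + 1, by positivity, fun T x => ?_⟩
  have hT : T.1 ∈ closure Λ.orbit := (Ω.hull_eq Λ hΛ).symm.subset T.2
  have hN0 : 0 < ‖x‖ + R + 1 := by positivity
  -- The bound on `δ⁻¹` makes the point of the translate of `Λ` near `x` a matched one; its partner
  -- moves by less than `1`, which accounts for `R + 1`.
  obtain ⟨δ, hδ0, hδ1, hδ2⟩ : ∃ δ : ℝ, 0 < δ ∧ δ ≤ 1 ∧ ‖x‖ + R + 1 ≤ δ⁻¹ := by
    refine ⟨min 1 (‖x‖ + R + 1)⁻¹, by positivity, min_le_left _ _, ?_⟩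
    rw [le_inv_comm₀ (by positivity) (by positivity)]
    exact min_le_right _ _
  obtain ⟨_, ⟨M, a1, -, -, a4⟩, ⟨y, rfl⟩⟩ :=
    mem_closure_iff_nhds.1 hT _ ((LabeledDelone.hasBasis_nhds T.1).mem_of_mem hδ0)
  obtain ⟨q, hq, hqy⟩ := hd (x + y)
  have hqx : dist (q.1 - y) x < R := by
    rwa [← dist_add_right _ _ y, sub_add_cancel]
  obtain ⟨p, hp⟩ := a4 (q.1 - y, q.2) (by simpa [LabeledDelone.mem_sub] using hq) (by
    change ‖q.1 - y‖ < _
    rw [dist_eq_norm] at hqx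
    linarith [norm_sub_norm_le (q.1 - y) x])
  obtain ⟨b1, -, b2⟩ := a1 _ _ hp
  have b3 : dist p.1 (q.1 - y) < δ := (le_max_left _ _).trans_lt b2
  exact ⟨p, b1, by linarith [dist_triangle p.1 (q.1 - y) x]⟩

/-- Tiling spaces with labels in a compact space are compact: an ultrafilter converges to the
set of limits of the points of its elements. -/
instance compactSpace [CompactSpace X] (Ω : TilingSpace d X) : CompactSpace Ω := by
  rw [← isCompact_iff_compactSpace, isCompact_iff_ultrafilter_le_nhds]
  intro U hU
  have hΩ : ∀ᶠ T : LabeledDelone d X in U, T ∈ Ω.carrier := Filter.le_principal_iff.1 hU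
  let C : Set (Euc d × X) := {p | ∀ ε : ℝ, 0 < ε →
    ∀ᶠ T : LabeledDelone d X in U, ∃ q ∈ T.carrier, dist q p < ε}
  -- Choose a point in the ball from `U`-almost every element and take the limit of the image
  -- ultrafilter in the compact set ball × labels. The property `Q` is carried along so that the
  -- approximating points are known to satisfy it.
  have hlim : ∀ (x : Euc d) (R : ℝ) (Q : LabeledDelone d X → Euc d × X → Prop),
      (∀ᶠ T : LabeledDelone d X in U, ∃ q ∈ T.carrier, dist q.1 x ≤ R ∧ Q T q) →
      ∃ p ∈ C, dist p.1 x ≤ R ∧ ∀ ε : ℝ, 0 < ε →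
        ∀ᶠ T : LabeledDelone d X in U, ∃ q ∈ T.carrier, dist q p < ε ∧ Q T q := by
    intro x R Q hQ
    obtain ⟨T₀, q₀, -⟩ := hQ.exists
    have : ∀ T : LabeledDelone d X, ∃ q : Euc d × X, (∃ q ∈ T.carrier, dist q.1 x ≤ R ∧ Q T q) →
        q ∈ T.carrier ∧ dist q.1 x ≤ R ∧ Q T q := by
      intro T
      by_cases h : ∃ q ∈ T.carrier, dist q.1 x ≤ R ∧ Q T q
      · exact ⟨h.choose, fun _ => h.choose_spec⟩
      · exact ⟨q₀, fun h' => absurd h' h⟩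
    choose f hf using this
    have hK : IsCompact (Metric.closedBall x R ×ˢ (Set.univ : Set X)) :=
      (isCompact_closedBall x R).prod isCompact_univ
    obtain ⟨p, hp, hle⟩ := isCompact_iff_ultrafilter_le_nhds.1 hK (U.map f) (by
      rw [Filter.le_principal_iff]
      exact hQ.mono fun T hT => ⟨(hf T hT).2.1, trivial⟩)
    have hp' : ∀ ε : ℝ, 0 < ε →
        ∀ᶠ T : LabeledDelone d X in U, ∃ q ∈ T.carrier, dist q p < ε ∧ Q T q := by
      intro ε hε
      have h1 : ∀ᶠ T : LabeledDelone d X in U, dist (f T) p < ε := hle (Metric.ball_mem_nhds p hε)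
      filter_upwards [h1, hQ] with T h2 h3
      exact ⟨f T, (hf T h3).1, h2, (hf T h3).2.2⟩
    exact ⟨p, fun ε hε => (hp' ε hε).mono fun T ⟨q, h1, h2, _⟩ => ⟨q, h1, h2⟩, hp.1, hp'⟩
  have hsep : ∀ p ∈ C, ∀ q ∈ C, dist p.1 q.1 < 2 * Ω.radius → p = q := by
    intro p hp q hq hd
    by_contra hne
    -- The first bound makes the approximants of `p` and `q` in one `T` closer than `2ρ`, hence
    -- equal; the second makes that impossible when `p ≠ q`.
    have h0 : 0 < min ((2 * Ω.radius - dist p.1 q.1) / 2) (dist p q / 2) :=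
      lt_min (by linarith) (half_pos (dist_pos.2 hne))
    obtain ⟨T, ⟨p', hp', hpp⟩, ⟨q', hq', hqq⟩, hT⟩ := ((hp _ h0).and ((hq _ h0).and hΩ)).exists
    have h1 : dist p'.1 p.1 < (2 * Ω.radius - dist p.1 q.1) / 2 :=
      (le_max_left _ _).trans_lt (hpp.trans_le (min_le_left _ _))
    have h2 : dist q'.1 q.1 < (2 * Ω.radius - dist p.1 q.1) / 2 :=
      (le_max_left _ _).trans_lt (hqq.trans_le (min_le_left _ _))
    have h3 := dist_triangle4 p'.1 p.1 q.1 q'.1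
    rw [dist_comm q.1] at h3
    have h4 : p' = q' := Ω.radius_spec ⟨T, hT⟩ hp' hq' (by linarith)
    have h5 := dist_triangle_left p q p'
    rw [h4] at h5
    rw [h4] at hpp
    linarith [hpp.trans_le (min_le_right _ _), hqq.trans_le (min_le_right _ _)]
  obtain ⟨R, hR, hcov⟩ := Ω.exists_covering_radius
  let Λ : LabeledDelone d X :=
    { carrier := C
      separated := ⟨2 * Ω.radius, by linarith [Ω.radius_pos], fun p hp q hq hne =>
        not_lt.1 fun h => hne (hsep p hp q hq h)⟩
      relDense := ⟨R + 1, by positivity, fun x => by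
        obtain ⟨p, hp, hx, -⟩ := hlim x R (fun _ _ => True) (hΩ.mono fun T hT => by
          simpa using hcov ⟨T, hT⟩ x)
        exact ⟨p, hp, by linarith⟩⟩ }
  have hconv : (U : Filter (LabeledDelone d X)) ≤ 𝓝 Λ := by
    rw [(LabeledDelone.hasBasis_nhds Λ).ge_iff]
    intro ε hε
    have hη : 0 < min ε Ω.radius := lt_min hε Ω.radius_pos
    have h1 : ∀ᶠ T : LabeledDelone d X in U, ∀ p ∈ Λ.patch 0 ε⁻¹,
        ∃ q ∈ T.carrier, dist q p < min ε Ω.radius :=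
      (Filter.eventually_all_finite (Λ.patch_finite 0 ε⁻¹)).2 fun p hp => hp.1 _ hη
    -- Otherwise, by the ultrafilter property, almost every `T` has a point in the ball far from
    -- `C`; a limit of such points lies in `C`, a contradiction.
    have h2 : ∀ᶠ T : LabeledDelone d X in U, ∀ q ∈ T.carrier, ‖q.1‖ < ε⁻¹ →
        ∃ p ∈ C, dist q p < min ε Ω.radius := by
      by_contra hcon
      rw [← Ultrafilter.eventually_not] at hcon
      obtain ⟨p, hp, -, hev⟩ := hlim 0 ε⁻¹ (fun T q => ¬∃ p ∈ C, dist q p < min ε Ω.radius)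
        (hcon.mono fun T hT => by
          push Not at hT
          obtain ⟨q, hq, hn, hfar⟩ := hT
          exact ⟨q, hq, by simpa using hn.le, by push Not; exact hfar⟩)
      obtain ⟨T, q, -, hd, hnot⟩ := (hev _ hη).exists
      exact hnot ⟨p, hp, hd⟩
    filter_upwards [h1, h2, hΩ] with T h1 h2 hT
    have hfst : ∀ {p q : Euc d × X}, dist q p < min ε Ω.radius → dist q.1 p.1 < Ω.radius :=
      fun h => (le_max_left _ _).trans_lt (h.trans_le (min_le_right _ _))
    -- Matched points are closer than `ρ` while distinct points on either side are at least `2ρ`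
    -- apart, so the matching is one-to-one.
    refine ⟨fun p q => p ∈ C ∧ q ∈ T.carrier ∧ dist q p < min ε Ω.radius, ?_, ⟨?_, ?_⟩, ?_, ?_⟩
    · rintro p q ⟨a, b, c⟩
      exact ⟨a, b, by rw [dist_comm]; exact c.trans_le (min_le_left _ _)⟩
    · rintro p q s ⟨a, b, c⟩ ⟨a', b', c'⟩
      exact hsep _ a _ a' (by linarith [hfst c, hfst c', dist_triangle_left p.1 q.1 s.1])
    · rintro p q s ⟨a, b, c⟩ ⟨a', b', c'⟩
      exact Ω.radius_spec ⟨T, hT⟩ b b'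
        (by linarith [hfst c, hfst c', dist_triangle_right q.1 s.1 p.1])
    · intro p hp hn
      obtain ⟨q, hq, hd⟩ := h1 p (LabeledDelone.mem_patch_zero.2 ⟨hp, hn⟩)
      exact ⟨q, hp, hq, hd⟩
    · intro q hq hn
      obtain ⟨p, hp, hd⟩ := h2 q hq hn
      exact ⟨p, hp, hq, hd⟩
  have hclosed : IsClosed Ω.carrier := by
    obtain ⟨Λ₀, hΛ₀⟩ := Ω.nonempty
    rw [← Ω.hull_eq Λ₀ hΛ₀]
    exact isClosed_closure
  exact ⟨Λ, hclosed.mem_of_tendsto (Filter.tendsto_id.mono_left hconv) hΩ, hconv⟩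

/-! ### Local constancy of recentred patches under FLC -/

/-- In an FLC tiling space, the patches of a given radius around points, translated to the origin,
are contained in a finite set. -/
theorem FLC.exists_finite {Ω : TilingSpace d X} (hΩ : Ω.FLC) (R : ℝ) :
    ∃ D : Set (Euc d × X), D.Finite ∧ ∀ (T : Ω) (x : Euc d) (l : X), (x, l) ∈ T.1.carrier →
      (T.1.sub x).patch 0 R ⊆ D := by
  obtain ⟨F, hF, hP⟩ := hΩ R
  -- FLC controls patches only up to an unknown translation `z`, which cancels in differences of
  -- positions. Infinite members of `F` are never patches and are discarded.
  refine ⟨⋃ P ∈ {P ∈ F | P.Finite}, (fun a : (Euc d × X) × (Euc d × X) =>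
    (a.1.1 - a.2.1, a.1.2)) '' (P ×ˢ P), (hF.subset (Set.sep_subset _ _)).biUnion
      fun P hP => (hP.2.prod hP.2).image _, ?_⟩
  intro T x l hx p hp
  -- A nonempty patch has positive radius, so it contains its own centre `(x, l)`, the second point
  -- of the difference.
  have hR : 0 < R := (norm_nonneg p.1).trans_lt (LabeledDelone.mem_patch_zero.1 hp).2
  rw [LabeledDelone.mem_patch_sub] at hp
  obtain ⟨z, hz⟩ := hP T x
  refine Set.mem_biUnion (x := (fun p : Euc d × X => (p.1 - z, p.2)) '' T.1.patch x R)
    ⟨hz, (LabeledDelone.patch_finite _ _ _).image _⟩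
    ⟨((p.1 + x - z, p.2), (x - z, l)), ⟨⟨_, hp, rfl⟩, ⟨(x, l), ⟨hx, by simpa using hR⟩, rfl⟩⟩, ?_⟩
  simp

/-- In an FLC tiling space, the patch around the point of `T` near `x` is, up to
translation, a locally constant function of `T`. -/
theorem FLC.eventually_patch_eq {Ω : TilingSpace d X} (hΩ : Ω.FLC) {x : Euc d} {T : Ω}
    (hx : T ∈ Ω.cell x) (r : ℝ) :
    ∀ᶠ T' in 𝓝 T, (T'.1.sub (Ω.pos x T')).patch 0 r = (T.1.sub (Ω.pos x T)).patch 0 r := by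
  obtain ⟨D, hD, h⟩ := hΩ.exists_finite (r + 1)
  have hmem : ∀ T', T' ∈ Ω.cell x → (T'.1.sub (Ω.pos x T')).patch 0 (r + 1) ⊆ D := by
    intro T' hT'
    obtain ⟨l, hl, -⟩ := Ω.exists_pos hT'
    exact h T' _ l hl
  -- The recentred set depends continuously on `T'` and its patches stay in the finite set `D`, so
  -- they cannot vary locally.
  have hc : ContinuousAt (fun T' : Ω => T'.1.sub (Ω.pos x T')) T :=
    LabeledDelone.continuous_sub.continuousAt.comp
      (continuous_subtype_val.continuousAt.prodMk (Ω.continuousAt_pos hx))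
  filter_upwards [hc.eventually (LabeledDelone.eventually_patch_eq hD (hmem T hx)),
    (Ω.isOpen_cell x).mem_nhds hx] with T' h1 h2
  exact h1 (hmem T' h2)

/-! ### Locality of the factor map -/

variable {X' : Type*} [MetricSpace X']

/-- On a compact tiling space, locality may be checked on a neighbourhood of each element. -/
theorem isLocalMap_of_eventually [CompactSpace X] {Ω : TilingSpace d X} {Ω' : TilingSpace d X'}
    {φ : C(Ω, Ω')} (h : ∀ (r : ℝ) (T₀ : Ω), ∃ R : ℝ, ∃ W ∈ 𝓝 T₀, ∀ T ∈ W, ∀ T' ∈ W,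
      T.1.patch 0 R = T'.1.patch 0 R → (φ T).1.patch 0 r = (φ T').1.patch 0 r) :
    IsLocalMap φ := by
  intro r _
  choose R W hW hloc using h r
  obtain ⟨t, -, ht⟩ := isCompact_univ.elim_nhds_subcover (fun T => interior (W T))
    fun T _ => interior_mem_nhds.2 (hW T)
  obtain ⟨V, hV, hVt⟩ := lebesgue_number_lemma (K := (Set.univ : Set Ω))
    (U := fun T : t => interior (W T.1)) isCompact_univ (fun _ => isOpen_interior)
    (by simpa [Set.iUnion_subtype] using ht)
  rw [uniformity_subtype, Filter.mem_comap] at hV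
  obtain ⟨V', hV', hVV'⟩ := hV
  obtain ⟨ε, hε, hεV⟩ := LabeledDelone.hasBasis_uniformity.mem_iff.1 hV'
  obtain ⟨B, hB⟩ := (t.image R).bddAbove
  have hpos : 0 < ε⁻¹ := inv_pos.2 hε
  -- Agreement up to `ε⁻¹` puts `T` and `T'` in a common member of the finite subcover, by the
  -- Lebesgue entourage; `B` bounds the radii attached to these members.
  refine ⟨max ε⁻¹ B, lt_max_of_lt_left hpos, fun T T' hTT' => ?_⟩
  obtain ⟨⟨S, hS⟩, hball⟩ := hVt T trivial
  refine hloc S T (interior_subset (hball (hVV' (hεV (LabeledDelone.Near.refl hε T.1))))) T'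
    (interior_subset (hball (hVV' (hεV (LabeledDelone.near_of_patch_eq hε (le_max_left _ _)
      hTT'))))) (LabeledDelone.patch_mono_of_eq ?_ hTT')
  exact (hB (Finset.mem_coe.2 (Finset.mem_image_of_mem R hS))).trans (le_max_right _ _)

/-- A large patch around the origin determines the positions of points. -/
theorem pos_eq_of_patch_eq {Ω : TilingSpace d X} {x : Euc d} {T T' : Ω} (hx : T ∈ Ω.cell x) {R : ℝ}
    (hR : ‖x‖ + Ω.radius ≤ R) (h : T.1.patch 0 R = T'.1.patch 0 R) : Ω.pos x T = Ω.pos x T' := by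
  obtain ⟨p, hp, hd⟩ := hx
  have h1 : ‖p.1‖ < R := by
    have := dist_eq_norm p.1 x
    linarith [norm_sub_norm_le p.1 x]
  have h2 : p ∈ T'.1.patch 0 R := h ▸ LabeledDelone.mem_patch_zero.2 ⟨hp, h1⟩
  rw [Ω.pos_eq hp hd, Ω.pos_eq h2.1 hd]

variable {X₁ X₂ : Type*} [MetricSpace X₁] [MetricSpace X₂]
  {Ω : TilingSpace d X} {Ω₁ : TilingSpace d X₁} {Ω₂ : TilingSpace d X₂}

/-- If `s` is locally the difference of the positions of points of `h₂ T` and `h₁ T`, up to a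
constant, then `h₁ T ↦ h₂ T - s T` is a local map. -/
theorem isLocalMap_of_eventually_eq [CompactSpace X₁] (F₂ : Ω₂.FLC) {h₁ : Ω ≃ₜ Ω₁}
    {h₂ : C(Ω, Ω₂)} {s : Ω → Euc d} {φ : C(Ω₁, Ω₂)} (hφ : ∀ T, φ (h₁ T) = sub (h₂ T) (s T))
    (hs : ∀ T₀, ∃ x y c, h₁ T₀ ∈ Ω₁.cell x ∧ h₂ T₀ ∈ Ω₂.cell y ∧
        ∀ᶠ T in 𝓝 T₀, s T = Ω₂.pos y (h₂ T) - Ω₁.pos x (h₁ T) + c) :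
    IsLocalMap φ := by
  refine isLocalMap_of_eventually fun r T₁ => ?_
  obtain ⟨T₀, rfl⟩ := h₁.surjective T₁
  obtain ⟨x, y, c, hx, hy, hev⟩ := hs T₀
  -- The extra radius bounds the norm of the translation `c - Ω₁.pos x (h₁ T)`, since the position
  -- lies within `Ω₁.radius` of `x`.
  have hpatch := h₂.continuous.continuousAt.eventually
    (F₂.eventually_patch_eq hy (r + (‖x‖ + Ω₁.radius + ‖c‖)))
  have hcell := h₁.continuous.continuousAt.eventually ((Ω₁.isOpen_cell x).mem_nhds hx)
  refine ⟨‖x‖ + Ω₁.radius, h₁ '' {T | s T = Ω₂.pos y (h₂ T) - Ω₁.pos x (h₁ T) + c ∧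
    ((h₂ T).1.sub (Ω₂.pos y (h₂ T))).patch 0 (r + (‖x‖ + Ω₁.radius + ‖c‖)) =
      ((h₂ T₀).1.sub (Ω₂.pos y (h₂ T₀))).patch 0 (r + (‖x‖ + Ω₁.radius + ‖c‖)) ∧
    h₁ T ∈ Ω₁.cell x}, ?_, ?_⟩
  · exact h₁.isOpenMap.image_mem_nhds (hev.and (hpatch.and hcell))
  · rintro _ ⟨T, ⟨a1, a2, a3⟩, rfl⟩ _ ⟨T', ⟨b1, b2, b3⟩, rfl⟩ heq
    have hpos := pos_eq_of_patch_eq a3 le_rfl heq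
    -- This separates the two dependencies: the patch of the recentred `h₂ T` is constant on the
    -- neighbourhood, and the remaining translation depends only on one point of `h₁ T`, seen in its
    -- patch of radius `‖x‖ + Ω₁.radius`.
    have hφ' : ∀ T, s T = Ω₂.pos y (h₂ T) - Ω₁.pos x (h₁ T) + c → (φ (h₁ T)).1 =
        ((h₂ T).1.sub (Ω₂.pos y (h₂ T))).sub (c - Ω₁.pos x (h₁ T)) := by
      intro T hT
      rw [hφ, LabeledDelone.sub_sub]
      change (h₂ T).1.sub (s T) = _
      rw [hT]
      congr 1
      abel
    rw [hφ' T a1, hφ' T' b1, hpos]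
    refine LabeledDelone.patch_sub_eq ?_ (a2.trans b2.symm)
    obtain ⟨l, -, hl⟩ := Ω₁.exists_pos b3
    rw [dist_eq_norm] at hl
    linarith [norm_sub_le c (Ω₁.pos x (h₁ T')), norm_sub_norm_le (Ω₁.pos x (h₁ T')) x]

end TilingSpace

/-! ### The theorem -/

theorem mainTheorem4 {d : ℕ} {X X₁ X₂ : Type*}
    [MetricSpace X] [CompactSpace X] [MetricSpace X₁] [CompactSpace X₁]
    [MetricSpace X₂] [CompactSpace X₂]
    (Ω : TilingSpace d X) (Ω₁ : TilingSpace d X₁) (Ω₂ : TilingSpace d X₂)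
    (h₁ : Ω ≃ₜ Ω₁) (hh₁ : TilingSpace.IsOrbitEquivalence h₁)
    (h₂ : C(Ω, Ω₂)) (hh₂ : TilingSpace.OrbitPreserving h₂) :
    (TilingSpace.weakClass (h₁ : C(Ω, Ω₁)) hh₁.orbitPreserving = TilingSpace.weakClass h₂ hh₂ →
      ∃ φ : C(Ω₁, Ω₂), TilingSpace.IsFactorMap φ ∧
        ContinuousMap.Homotopic h₂ (φ.comp (h₁ : C(Ω, Ω₁)))) ∧
    (∀ (_ : Ω.FLC) (F₁ : Ω₁.FLC) (F₂ : Ω₂.FLC),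
      TilingSpace.strongClass (h₁ : C(Ω, Ω₁)) F₁ = TilingSpace.strongClass h₂ F₂ →
        ∃ φ : C(Ω₁, Ω₂), TilingSpace.IsLocalDerivation φ ∧
          ContinuousMap.Homotopic h₂ (φ.comp (h₁ : C(Ω, Ω₁)))) := by
  refine ⟨fun h => ?_, fun _ F₁ F₂ h => ?_⟩
  · obtain ⟨s, hs⟩ := TilingSpace.exists_of_weakClass_eq h
    obtain ⟨φ, hφ, hhom, -⟩ := TilingSpace.exists_factorMap hh₁ hh₂ s hs
    exact ⟨φ, hφ, hhom⟩
  · obtain ⟨s, hs, hloc⟩ := TilingSpace.exists_of_strongClass_eq hh₁.orbitPreserving hh₂ h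
    obtain ⟨φ, hφ, hhom, hval⟩ := TilingSpace.exists_factorMap hh₁ hh₂ s hs
    exact ⟨φ, ⟨TilingSpace.isLocalMap_of_eventually_eq F₂ hval hloc, hφ⟩, hhom⟩
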